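/- Let $A$ be a separable (not necessarily unital) C*-algebra. Then the following are equivalent: 1. $A$ is liminary (CCR), i.e. $\pi(A)\subseteq K(H)$ for every irreducible representation $\pi$ of $A$ on a Hilbert space $H$; 2. $A$ is type $I_\alpha$ for some countable ordinal $\alpha$, i.e. $A=\Pi_{1+\alpha}(A)$ for some $\alpha<\omega_1$. Here $\mathrm{Prim}(A)$ is the set of kernels of irreducible representations of $A$ with the Jacobson topology, whose closed sets are the sets $\{P : I\subseteq P\}$ for closed two-sided ideals $I$ of $A$. For a topological space $X$ and a function $w:X\to\mathbb N\cup\{\infty\}$, the order $o_w(x)$ of a point $x$ is defined recursively: $o_w(x)$ is the least ordinal $\alpha$ such that $w(x)<\infty$ and there are a neighbourhood $U$ of $x$ and $n\in\mathbb N$ such that every $y\in U$ satisfies $o_w(y)<\alpha$ or $w(y)\le n$; and $o_w(x)=\infty$ if there is no such $\alpha$. (Thus $o_w(x)=0$ iff $w$ is bounded by a natural number near $x$.) The rank of $x$ is $r_w(x)=\omega\, o_w(x)+w(x)$, with $r_w(x)=\infty$ if $o_w(x)=\infty$, and the rank of $w$ is $r(w)=\sup_{x\in X} r_w(x)$. For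 $a\in A$ let $w_a:\mathrm{Prim}(A)\to\mathbb N\cup\{\infty\}$, $w_a(\ker\rho)=\mathrm{rank}\,\rho(a)$ (this depends only on $\ker\rho$). The Pedersen rank of $a$ is $r_P(a)=r(w_a)$, and the Fell ideal $\Pi_\alpha(A)$ is the closed two-sided ideal of $A$ generated by all $a\in A$ with $r_P(a)\le\alpha$. -/

import Mathlib

open scoped Topology

universe u

namespace CStarRank

section Representations

variable {A : Type u} [NonUnitalCStarAlgebra A]
variable {H : Type u} [NormedAddCommGroup H] [InnerProductSpace ℂ H] [CompleteSpace H]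

/-- A representation `π` of `A` on the Hilbert space `H` is irreducible if it is nonzero and the
only closed subspaces of `H` invariant under `π(A)` are `0` and `H`.
Every irreducible representation of `A : Type u` is cyclic, hence unitarily equivalent to one on a
Hilbert space in `Type u`; so throughout it is enough to consider Hilbert spaces in `Type u`. -/
def IsIrreducible (π : A →⋆ₙₐ[ℂ] (H →L[ℂ] H)) : Prop :=
  (∃ a : A, π a ≠ 0) ∧
    ∀ K : Submodule ℂ H, IsClosed (K : Set H) → (∀ a : A, ∀ x ∈ K, π a x ∈ K) → K = ⊥ ∨ K = ⊤

/-- The kernel of a representation. -/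
def kernel (π : A →⋆ₙₐ[ℂ] (H →L[ℂ] H)) : Submodule ℂ A where
  carrier := {a | π a = 0}
  add_mem' := by
    intro a b ha hb
    simp only [Set.mem_ofPred_eq] at ha hb ⊢
    rw [map_add, ha, hb, add_zero]
  zero_mem' := by simp
  smul_mem' := by
    intro c a ha
    simp only [Set.mem_ofPred_eq] at ha ⊢
    rw [map_smul, ha, smul_zero]

theorem mem_kernel {π : A →⋆ₙₐ[ℂ] (H →L[ℂ] H)} {a : A} : a ∈ kernel π ↔ π a = 0 := Iff.rfl

end Representations

section Ideals

variable (A : Type u) [NonUnitalCStarAlgebra A]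

/-- `A` is liminary (CCR) if every irreducible representation maps `A` into the compact
operators. -/
def IsLiminary : Prop :=
  ∀ (H : Type u) [NormedAddCommGroup H] [InnerProductSpace ℂ H] [CompleteSpace H]
    (π : A →⋆ₙₐ[ℂ] (H →L[ℂ] H)), IsIrreducible π → ∀ a : A, IsCompactOperator (π a)

variable {A}

/-- Closed two-sided ideals of `A`. -/
def IsClosedIdeal (I : Submodule ℂ A) : Prop :=
  IsClosed (I : Set A) ∧ ∀ a : A, ∀ x ∈ I, a * x ∈ I ∧ x * a ∈ I

/-- The closed two-sided ideal generated by a set. -/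
def closedIdealSpan (S : Set A) : Submodule ℂ A :=
  sInf {I : Submodule ℂ A | IsClosedIdeal I ∧ S ⊆ I}

theorem closedIdealSpan_isClosedIdeal (S : Set A) : IsClosedIdeal (closedIdealSpan S) := by
  constructor
  · rw [closedIdealSpan, Submodule.coe_sInf]
    exact isClosed_biInter fun I hI => hI.1.1
  · intro a x hx
    rw [closedIdealSpan, Submodule.mem_sInf] at hx
    constructor
    · rw [closedIdealSpan, Submodule.mem_sInf]
      exact fun I hI => (hI.1.2 a x (hx I hI)).1
    · rw [closedIdealSpan, Submodule.mem_sInf]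
      exact fun I hI => (hI.1.2 a x (hx I hI)).2

theorem subset_closedIdealSpan (S : Set A) : S ⊆ closedIdealSpan S := by
  intro x hx
  rw [closedIdealSpan, SetLike.mem_coe, Submodule.mem_sInf]
  exact fun I hI => hI.2 hx

theorem closedIdealSpan_le {S : Set A} {I : Submodule ℂ A} (hI : IsClosedIdeal I) (h : S ⊆ I) :
    closedIdealSpan S ≤ I :=
  sInf_le ⟨hI, h⟩

/-- A primitive ideal is the kernel of an irreducible representation. -/
def IsPrimitive (I : Submodule ℂ A) : Prop :=
  ∃ (H : Type u) (_ : NormedAddCommGroup H) (_ : InnerProductSpace ℂ H) (_ : CompleteSpace H)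
    (π : A →⋆ₙₐ[ℂ] (H →L[ℂ] H)), IsIrreducible π ∧ kernel π = I

theorem IsPrimitive.ne_top {I : Submodule ℂ A} (hI : IsPrimitive I) : I ≠ ⊤ := by
  obtain ⟨H, _, _, _, π, hπ, rfl⟩ := hI
  obtain ⟨a, ha⟩ := hπ.1
  intro h
  exact ha (mem_kernel.1 (h ▸ Submodule.mem_top))

theorem IsPrimitive.isClosedIdeal {P : Submodule ℂ A} (hP : IsPrimitive P) : IsClosedIdeal P := by
  obtain ⟨H, _, _, _, π, hπ, rfl⟩ := hP
  constructor
  · have hc : Continuous π :=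
      AddMonoidHomClass.continuous_of_bound π 1 fun a => by
        simpa only [one_mul] using NonUnitalStarAlgHom.norm_apply_le π a
    exact isClosed_singleton.preimage hc
  · intro a x hx
    simp only [mem_kernel] at hx ⊢
    simp [hx]

/-- Primitive ideals are prime. -/
theorem IsPrimitive.le_or_le {P : Submodule ℂ A} (hP : IsPrimitive P) {I J : Submodule ℂ A}
    (hI : IsClosedIdeal I) (hJ : IsClosedIdeal J) (h : I ⊓ J ≤ P) : I ≤ P ∨ J ≤ P := by
  obtain ⟨H, _, _, _, π, hπ, rfl⟩ := hP
  by_contra! hcon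
  obtain ⟨hIP, hJP⟩ := hcon
  -- the vectors killed by `π(I)`
  let K : Submodule ℂ H :=
    { carrier := {v | ∀ i ∈ I, π i v = 0}
      add_mem' := by
        intro v w hv hw i hi
        rw [map_add, hv i hi, hw i hi, add_zero]
      zero_mem' := by
        intro i _
        exact map_zero _
      smul_mem' := by
        intro c v hv i hi
        rw [map_smul, hv i hi, smul_zero] }
  have hK : ∀ v, v ∈ K ↔ ∀ i ∈ I, π i v = 0 := fun v => Iff.rfl
  have hKc : IsClosed (K : Set H) := by
    have : (K : Set H) = ⋂ i ∈ I, {v | π i v = 0} := by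
      ext v
      simp [hK]
    rw [this]
    exact isClosed_biInter fun i _ => isClosed_eq (π i).continuous continuous_const
  have hKi : ∀ a : A, ∀ x ∈ K, π a x ∈ K := by
    intro a x hx i hi
    have := hx (i * a) (hI.2 a i hi).2
    rwa [map_mul] at this
  rcases hπ.2 K hKc hKi with h0 | h1
  · apply hJP
    intro j hj
    rw [mem_kernel]
    ext v
    have : π j v ∈ K := by
      intro i hi
      have hij : i * j ∈ I ⊓ J := ⟨(hI.2 j i hi).2, (hJ.2 i j hj).1⟩
      have h2 := mem_kernel.1 (h hij)
      rw [map_mul] at h2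
      exact DFunLike.congr_fun h2 v
    rw [h0, Submodule.mem_bot] at this
    simpa using this
  · apply hIP
    intro i hi
    rw [mem_kernel]
    ext v
    have : v ∈ K := h1 ▸ Submodule.mem_top
    simpa using this i hi

variable (A) in
/-- The primitive spectrum `Prim(A)`: the set of primitive ideals of `A`. -/
def Prim : Type u := {P : Submodule ℂ A // IsPrimitive P}

/-- The hull of `I`: the primitive ideals containing `I`. -/
def hull (I : Submodule ℂ A) : Set (Prim A) := {P | I ≤ P.1}

/-- The Jacobson topology on `Prim(A)`: the closed sets are exactly the hulls of closed ideals. -/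
instance jacobsonTopology : TopologicalSpace (Prim A) :=
  TopologicalSpace.ofClosed {C | ∃ I : Submodule ℂ A, IsClosedIdeal I ∧ C = hull I}
    (by
      refine ⟨⊤, ⟨isClosed_univ, fun _ _ _ => ⟨trivial, trivial⟩⟩, ?_⟩
      symm
      rw [Set.eq_empty_iff_forall_notMem]
      exact fun P hP => P.2.ne_top (top_le_iff.1 hP))
    (by
      intro 𝒞 h𝒞
      refine ⟨closedIdealSpan {x | ∃ I : Submodule ℂ A, IsClosedIdeal I ∧ hull I ∈ 𝒞 ∧ x ∈ I},
        closedIdealSpan_isClosedIdeal _, ?_⟩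
      ext P
      constructor
      · intro hP
        refine closedIdealSpan_le P.2.isClosedIdeal ?_
        rintro x ⟨I, _, hI, hx⟩
        exact (Set.mem_sInter.1 hP _ hI : I ≤ P.1) hx
      · intro hP
        rw [Set.mem_sInter]
        intro C hC
        obtain ⟨I, hI, rfl⟩ := h𝒞 hC
        exact fun x hx => hP (subset_closedIdealSpan _ ⟨I, hI, hC, hx⟩))
    (by
      rintro _ ⟨I, hI, rfl⟩ _ ⟨J, hJ, rfl⟩
      refine ⟨I ⊓ J, ⟨hI.1.inter hJ.1, fun a x hx =>
        ⟨⟨(hI.2 a x hx.1).1, (hJ.2 a x hx.2).1⟩, ⟨(hI.2 a x hx.1).2, (hJ.2 a x hx.2).2⟩⟩⟩, ?_⟩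
      ext P
      constructor
      · rintro (h | h)
        · exact fun x hx => h hx.1
        · exact fun x hx => h hx.2
      · exact fun h => P.2.le_or_le hI hJ h)

end Ideals

section Rank

variable {X : Type u} [TopologicalSpace X]

/-- `orderLE w α` is the set of points of order at most `α` with respect to `w : X → ℕ ∪ {∞}`:
`w x < ∞`, and on some neighbourhood of `x` the function `w` is bounded by a natural number
off the set of points of order `< α`. For `α = 0` this says that `w` is bounded near `x`. -/
def orderLE (w : X → ℕ∞) (α : Ordinal.{u}) : Set X :=
  {x | w x < ⊤ ∧ ∃ U ∈ 𝓝 x, ∃ n : ℕ, ∀ y ∈ U,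
    (∃ β : Ordinal.{u}, ∃ _ : β < α, y ∈ orderLE w β) ∨ w y ≤ n}
termination_by α

/-- The order `o_w(x)`: the least `α` such that `x` has order at most `α`, and `∞` if there is
none. -/
noncomputable def order (w : X → ℕ∞) (x : X) : WithTop Ordinal.{u} :=
  sInf ((fun α : Ordinal.{u} => (α : WithTop Ordinal.{u})) '' {α | x ∈ orderLE w α})

/-- The rank `r_w(x) = ω · o_w(x) + w(x)`, and `∞` if `o_w(x) = ∞`
(if `o_w(x) < ∞` then `w x` is a natural number). -/
noncomputable def pointRank (w : X → ℕ∞) (x : X) : WithTop Ordinal.{u} :=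
  (order w x).map fun α => Ordinal.omega0 * α + ((w x).toNat : Ordinal.{u})

/-- The rank `r(w)` of the function `w`: the supremum of the ranks of the points. -/
noncomputable def functionRank (w : X → ℕ∞) : WithTop Ordinal.{u} :=
  ⨆ x : X, pointRank w x

end Rank

section Pedersen

variable {A : Type u} [NonUnitalCStarAlgebra A]

/-- The rank of an operator, i.e. the dimension of its range, as an element of `ℕ ∪ {∞}`. -/
noncomputable def operatorRank {H : Type u} [NormedAddCommGroup H] [InnerProductSpace ℂ H]
    (T : H →L[ℂ] H) : ℕ∞ :=
  Cardinal.toENat (LinearMap.rank (T : H →ₗ[ℂ] H))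

/-- The Pedersen function `w_a : Prim(A) → ℕ ∪ {∞}`, `ker ρ ↦ rank ρ(a)`.
The number `rank ρ(a)` is the same for all irreducible `ρ` with a given kernel (if one such `ρ(a)`
is a nonzero operator of finite rank, then `ρ(A)` contains the compact operators and all irreducible
representations with this kernel are unitarily equivalent), so the supremum below is taken over a
set with exactly one element. -/
noncomputable def pedersenFunction (a : A) (P : Prim A) : ℕ∞ :=
  sSup {n : ℕ∞ | ∃ (H : Type u) (_ : NormedAddCommGroup H) (_ : InnerProductSpace ℂ H)
    (_ : CompleteSpace H) (ρ : A →⋆ₙₐ[ℂ] (H →L[ℂ] H)),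
      IsIrreducible ρ ∧ kernel ρ = P.1 ∧ n = operatorRank (ρ a)}

/-- The Pedersen rank `r_P(a)`. -/
noncomputable def pedersenRank (a : A) : WithTop Ordinal.{u} :=
  functionRank (pedersenFunction a)

variable (A) in
/-- The Fell ideal `Π_α(A)`: the closed ideal generated by the elements of Pedersen rank at most
`α`. -/
def fellIdeal (α : Ordinal.{u}) : Submodule ℂ A :=
  closedIdealSpan {a : A | pedersenRank a ≤ α}

variable (A) in
/-- `A` is type `I_α` if `A = Π_{1+α}(A)`. -/
def IsTypeI (α : Ordinal.{u}) : Prop := fellIdeal A (1 + α) = ⊤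

end Pedersen

end CStarRank

/-! If `A` is a Fell ideal, its generators have finite rank in every irreducible representation,
because the order is `∞` wherever the rank is. The elements that a given representation sends to
compact operators form a closed ideal, which is then all of `A`.

Conversely, let `A` be liminary and `b = (x⋆x - 2ε)₊`. Some compact operator is the identity on the
range of `ρ(b)`, so `b` has finite rank everywhere (`finiteDimensional_range_cut`). Rank `N` at `ρ`
produces `N` orthogonal elements of `bA` nonzero under `ρ` (`exists_orthogonal`). They stay nonzero
near `ker ρ`, so `w_b` is finite and lower semicontinuous. Closed subsets of `Prim A` are Baire
(`exists_open_inter_subset`), and separability makes `Prim A` hereditarily Lindelöf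
(`isLindelof_prim`). Hence the increasing open sets `orderLE w_b α`, `α < ω₁`, stabilise at a
countable `γ`. If they missed a point, Baire would give a nonempty relatively open part of the
complement on which `w_b` is bounded; its points have order at most `γ + 1`, a contradiction
(`exists_forall_mem_orderLE`). So `b` has countable Pedersen rank. Countably many such `b` generate
`A`, and a countable supremum of countable ordinals is countable. -/

namespace CStarRank

/-! ### Cutoffs by continuous functional calculus. -/

section Cutoff

/-- The function `t ↦ (t - ε)₊`. -/
def cut (ε t : ℝ) : ℝ := max (t - ε) 0

/-- The continuous function which is `0` up to `ε`, `1` from `2 * ε` on and linear in between. -/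
noncomputable def step (ε t : ℝ) : ℝ := min (max (t / ε - 1) 0) 1

theorem continuous_cut (ε : ℝ) : Continuous (cut ε) := by unfold cut; fun_prop

theorem continuous_step (ε : ℝ) : Continuous (step ε) := by unfold step; fun_prop

theorem cut_of_le {ε t : ℝ} (h : t ≤ ε) : cut ε t = 0 := max_eq_right (by linarith)

theorem step_of_le {ε t : ℝ} (hε : 0 < ε) (h : t ≤ ε) : step ε t = 0 := by
  have : t / ε ≤ 1 := (div_le_one hε).2 h
  rw [step, max_eq_right (by linarith), min_eq_left zero_le_one]

theorem step_of_two_mul_le {ε t : ℝ} (hε : 0 < ε) (h : 2 * ε ≤ t) : step ε t = 1 := by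
  have : 2 ≤ t / ε := (le_div_iff₀ hε).2 h
  exact min_eq_right (le_max_of_le_left (by linarith))

theorem step_nonneg (ε t : ℝ) : 0 ≤ step ε t := le_min (le_max_right _ _) zero_le_one

theorem step_le_one (ε t : ℝ) : step ε t ≤ 1 := min_le_right _ _

/-- `step ε` is already `1` where `cut (2 * ε)` is nonzero. This local unit is why cuts are taken at
`2 * ε` below. -/
theorem step_mul_cut {ε : ℝ} (hε : 0 < ε) (t : ℝ) : step ε t * cut (2 * ε) t = cut (2 * ε) t := by
  rcases le_total t (2 * ε) with h | h
  · rw [cut_of_le h, mul_zero]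
  · rw [step_of_two_mul_le hε h, one_mul]

theorem abs_sub_cut_le {ε t : ℝ} (hε : 0 ≤ ε) (ht : 0 ≤ t) : |cut ε t - t| ≤ ε := by
  rw [abs_le]
  rcases le_total t ε with h | h
  · rw [cut_of_le h]; constructor <;> linarith
  · rw [cut, max_eq_left (by linarith)]; constructor <;> linarith

variable {A : Type u} [NonUnitalCStarAlgebra A]

/-- If `f` vanishes near `0` then `f(a)` is a multiple of `a`. -/
theorem exists_cfcₙ_eq_mul {a : A} (ha : IsSelfAdjoint a) {f : ℝ → ℝ} (hf : Continuous f)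
    {ε : ℝ} (hε : 0 < ε) (h0 : ∀ t, |t| ≤ ε → f t = 0) :
    ∃ c : A, cfcₙ f a = a * c := by
  have hpos : ∀ t : ℝ, max (t ^ 2) (ε ^ 2) ≠ 0 := fun t =>
    (lt_max_of_lt_right (by positivity)).ne'
  -- A continuous form of `f t / t`: the two agree for `|t| ≥ ε`, and both vanish where `f` does.
  have hg : Continuous fun t : ℝ => f t * t / max (t ^ 2) (ε ^ 2) :=
    (hf.mul continuous_id).div (by fun_prop) hpos
  have hfg : f = fun t => t * (f t * t / max (t ^ 2) (ε ^ 2)) := by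
    funext t
    rcases le_or_gt |t| ε with h | h
    · simp [h0 t h]
    · have ht : ε ^ 2 ≤ t ^ 2 := by
        rw [← sq_abs t]; exact pow_le_pow_left₀ hε.le h.le 2
      have ht0 : t ≠ 0 := by
        rintro rfl; rw [abs_zero] at h; linarith
      rw [max_eq_left ht]
      field_simp
  refine ⟨cfcₙ (fun t : ℝ => f t * t / max (t ^ 2) (ε ^ 2)) a, ?_⟩
  conv_lhs => rw [hfg]
  rw [cfcₙ_mul (fun t : ℝ => t) _ a continuousOn_id rfl hg.continuousOn (by simp), cfcₙ_id' ℝ a]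

theorem exists_cut_eq_mul {a : A} (ha : IsSelfAdjoint a) {ε : ℝ} (hε : 0 < ε) :
    ∃ c : A, cfcₙ (cut ε) a = a * c :=
  exists_cfcₙ_eq_mul ha (continuous_cut ε) hε fun _ ht => cut_of_le ((le_abs_self _).trans ht)

theorem exists_step_eq_mul {a : A} (ha : IsSelfAdjoint a) {ε : ℝ} (hε : 0 < ε) :
    ∃ c : A, cfcₙ (step ε) a = a * c :=
  exists_cfcₙ_eq_mul ha (continuous_step ε) hε
    fun _ ht => step_of_le hε ((le_abs_self _).trans ht)

theorem cfcₙ_step_mul_cut (a : A) {ε : ℝ} (hε : 0 < ε) :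
    cfcₙ (step ε) a * cfcₙ (cut (2 * ε)) a = cfcₙ (cut (2 * ε)) a := by
  rw [← cfcₙ_mul (step ε) (cut (2 * ε)) a (continuous_step ε).continuousOn
    (step_of_le hε hε.le) (continuous_cut _).continuousOn (cut_of_le (by positivity))]
  simp only [step_mul_cut hε]

/-- `cut ε` is within `ε` of the identity only on `[0, ∞)`, so the element has to be positive. -/
theorem norm_cfcₙ_cut_sub_le (x : A) {ε : ℝ} (hε : 0 ≤ ε) :
    ‖cfcₙ (cut ε) (star x * x) - star x * x‖ ≤ ε := by
  let _ := CStarAlgebra.spectralOrder A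
  have := CStarAlgebra.spectralOrderedRing A
  have hsa : IsSelfAdjoint (star x * x) := .star_mul_self x
  have h : cfcₙ (fun t => cut ε t - t) (star x * x) = cfcₙ (cut ε) (star x * x) - star x * x := by
    rw [cfcₙ_sub (cut ε) (fun t => t) _ (continuous_cut ε).continuousOn (cut_of_le hε),
      cfcₙ_id' ℝ _]
  rw [← h]
  refine norm_cfcₙ_le fun t ht => ?_
  exact abs_sub_cut_le hε
    ((StarOrderedRing.nonneg_iff_quasispectrum_nonneg (R := ℝ) _ hsa).1 (star_mul_self_nonneg x) t ht)

end Cutoff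

/-! ### Burnside's theorem for nonunital algebras. -/

section Burnside

variable {V : Type*} [AddCommGroup V] [Module ℂ V] [FiniteDimensional ℂ V]

/-- Burnside's theorem: a transitive (not necessarily unital) algebra of operators on a
finite-dimensional complex vector space consists of all operators. -/
theorem eq_top_of_transitive (B : Submodule ℂ (Module.End ℂ V))
    (hmul : ∀ f ∈ B, ∀ g ∈ B, f * g ∈ B)
    (htrans : ∀ v : V, v ≠ 0 → ∀ w : V, ∃ f ∈ B, f v = w) : B = ⊤ := by
  rcases subsingleton_or_nontrivial V with hV | hV
  · have : Subsingleton (Module.End ℂ V) := ⟨fun f g => LinearMap.ext fun v => Subsingleton.elim _ _⟩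
    exact Subsingleton.elim _ _
  let S : Subalgebra ℂ (Module.End ℂ V) := Algebra.adjoin ℂ (B : Set (Module.End ℂ V))
  have hBS : ∀ f ∈ B, f ∈ S := fun f hf => Algebra.subset_adjoin hf
  have hsimple : IsSimpleModule S V := by
    rw [isSimpleModule_iff_toSpanSingleton_surjective]
    refine ⟨hV, fun v hv w => ?_⟩
    obtain ⟨f, hf, hfv⟩ := htrans v hv w
    exact ⟨⟨f, hBS f hf⟩, hfv⟩
  -- Schur: an eigenvector of `g` is moved to every vector by elements of `S`, which commute with
  -- `g`.
  have hschur : ∀ g : Module.End S V, ∃ c : ℂ, ∀ v : V, g v = c • v := by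
    intro g
    let g' : Module.End ℂ V :=
      { toFun := g
        map_add' := g.map_add
        map_smul' := fun c v => by
          simp }
    obtain ⟨c, hc⟩ := Module.End.exists_eigenvalue g'
    obtain ⟨v, hv⟩ := hc.exists_hasEigenvector
    refine ⟨c, fun w => ?_⟩
    obtain ⟨f, hf, rfl⟩ := htrans v hv.2 w
    have h1 : g ((⟨f, hBS f hf⟩ : S) • v) = (⟨f, hBS f hf⟩ : S) • g v := g.map_smul _ _
    have h2 : g v = c • v := hv.apply_eq_smul
    rw [h2] at h1
    exact h1.trans (f.map_smul c v)
  have hS : ∀ f : Module.End ℂ V, f ∈ S := by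
    intro f
    let f' : Module.End (Module.End S V) V :=
      { toFun := f
        map_add' := f.map_add
        map_smul' := fun g v => by
          obtain ⟨c, hc⟩ := hschur g
          simp only [Module.End.smul_def, RingHom.id_apply, hc, map_smul] }
    classical
    let b := Module.finBasis ℂ V
    obtain ⟨r, hr⟩ := jacobson_density f' (Finset.univ.image b)
    have : f = r.1 := by
      refine b.ext fun i => ?_
      exact hr (b i) (Finset.mem_image_of_mem _ (Finset.mem_univ i))
    rw [this]
    exact r.2
  -- `S` is `B` with a unit adjoined, so `B` is an ideal in it. As `S` is everything, `B` absorbs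
  -- all operators.
  have hideal : ∀ f ∈ S, ∀ g ∈ B, f * g ∈ B ∧ g * f ∈ B := by
    intro f hf
    induction hf using Algebra.adjoin_induction with
    | mem f hf => exact fun g hg => ⟨hmul f hf g hg, hmul g hg f hf⟩
    | algebraMap c =>
      intro g hg
      rw [← Algebra.commutes c g, Algebra.algebraMap_eq_smul_one, smul_mul_assoc, one_mul]
      exact ⟨B.smul_mem c hg, B.smul_mem c hg⟩
    | add f f' _ _ h h' =>
      intro g hg
      rw [add_mul, mul_add]
      exact ⟨B.add_mem (h g hg).1 (h' g hg).1, B.add_mem (h g hg).2 (h' g hg).2⟩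
    | mul f f' _ _ h h' =>
      intro g hg
      refine ⟨?_, ?_⟩
      · rw [mul_assoc]; exact (h _ (h' g hg).1).1
      · rw [← mul_assoc]; exact (h' _ (h g hg).2).2
  have hrank : ∀ (φ : V →ₗ[ℂ] ℂ) (u : V), φ.smulRight u ∈ B := by
    intro φ u
    obtain ⟨v, hv⟩ := exists_ne (0 : V)
    obtain ⟨g, hg, hgv⟩ := htrans v hv v
    obtain ⟨χ, hχ⟩ := Module.Projective.exists_dual_ne_zero ℂ hv
    have : φ.smulRight u = (((χ v)⁻¹ • χ).smulRight u * g) * φ.smulRight v := by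
      ext w
      simp [hgv, hχ]
    rw [this]
    exact (hideal _ (hS _) _ (hideal _ (hS _) g hg).1).2
  rw [eq_top_iff]
  intro f _
  let b := Module.finBasis ℂ V
  have : f = ∑ i, (b.coord i).smulRight (f (b i)) := by
    refine b.ext fun j => ?_
    simp [Finsupp.single_apply]
  rw [this]
  exact B.sum_mem fun i _ => hrank _ _

end Burnside

/-! ### Finite operator rank and finite-dimensional range. -/

section OperatorRank

variable {H : Type u} [NormedAddCommGroup H] [InnerProductSpace ℂ H]

theorem operatorRank_lt_top {T : H →L[ℂ] H}
    (hT : FiniteDimensional ℂ (LinearMap.range (T : H →ₗ[ℂ] H))) : operatorRank T < ⊤ := by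
  rw [operatorRank, Cardinal.toENat_lt_top]
  exact Module.rank_lt_aleph0 ℂ _

theorem operatorRank_eq_finrank {T : H →L[ℂ] H}
    (hT : FiniteDimensional ℂ (LinearMap.range (T : H →ₗ[ℂ] H))) :
    operatorRank T = Module.finrank ℂ (LinearMap.range (T : H →ₗ[ℂ] H)) := by
  rw [operatorRank, LinearMap.rank, ← Module.finrank_eq_rank]
  simp

theorem finiteDimensional_of_operatorRank_lt_top {T : H →L[ℂ] H} (hT : operatorRank T < ⊤) :
    FiniteDimensional ℂ (LinearMap.range (T : H →ₗ[ℂ] H)) := by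
  rw [operatorRank, Cardinal.toENat_lt_top] at hT
  exact Module.rank_lt_aleph0_iff.1 hT

end OperatorRank

/-! ### Finite rank operators in irreducible representations. -/

section FiniteRank

variable {A : Type u} [NonUnitalCStarAlgebra A]
variable {H : Type u} [NormedAddCommGroup H] [InnerProductSpace ℂ H] [CompleteSpace H]

theorem continuous_representation (ρ : A →⋆ₙₐ[ℂ] (H →L[ℂ] H)) : Continuous ρ :=
  AddMonoidHomClass.continuous_of_bound ρ 1 fun a => by
    simpa only [one_mul] using NonUnitalStarAlgHom.norm_apply_le ρ a

/-- Every nonzero vector is cyclic for an irreducible representation. -/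
theorem IsIrreducible.dense_range {ρ : A →⋆ₙₐ[ℂ] (H →L[ℂ] H)} (hρ : IsIrreducible ρ) {v : H}
    (hv : v ≠ 0) : Dense (Set.range fun a : A => ρ a v) := by
  let L : A →ₗ[ℂ] H :=
    { toFun := fun a => ρ a v
      map_add' := fun a b => by rw [map_add]; rfl
      map_smul' := fun c a => by rw [map_smul]; rfl }
  have hL : (LinearMap.range L : Set H) = Set.range fun a : A => ρ a v := rfl
  rcases hρ.2 (LinearMap.range L).topologicalClosure
    (Submodule.isClosed_topologicalClosure _) (by
      intro a x hx
      refine map_mem_closure (ρ a).continuous hx ?_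
      rintro _ ⟨b, rfl⟩
      exact ⟨a * b, by simp [L]⟩) with h | h
  · exfalso
    have hzero : ∀ a, ρ a v = 0 := by
      intro a
      have : ρ a v ∈ (LinearMap.range L).topologicalClosure :=
        Submodule.le_topologicalClosure _ ⟨a, rfl⟩
      rwa [h, Submodule.mem_bot] at this
    -- The common null space is closed and invariant and contains `v ≠ 0`, so it would be all of
    -- `H`, making `ρ` zero.
    let K : Submodule ℂ H := ⨅ a : A, LinearMap.ker (ρ a : H →ₗ[ℂ] H)
    have hK : ∀ x, x ∈ K ↔ ∀ a, ρ a x = 0 := fun x => by simp [K]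
    have hKc : IsClosed (K : Set H) := by
      have : (K : Set H) = ⋂ a : A, {x | ρ a x = 0} := by ext x; simp [hK]
      rw [this]
      exact isClosed_iInter fun a => isClosed_eq (ρ a).continuous continuous_const
    rcases hρ.2 K hKc (fun a x hx => by
      rw [(hK x).1 hx a]; exact K.zero_mem) with h0 | h1
    · exact hv (by simpa [h0] using (hK v).2 hzero)
    · obtain ⟨a, ha⟩ := hρ.1
      apply ha
      ext x
      exact (hK x).1 (h1 ▸ Submodule.mem_top) a
  · rw [← hL, ← Submodule.dense_iff_topologicalClosure_eq_top] at *
    exact h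

/-- If `ρ(a)` is compact for a self-adjoint `a`, then `ρ((a - 2ε)₊)` has finite rank. -/
theorem finiteDimensional_range_cut (ρ : A →⋆ₙₐ[ℂ] (H →L[ℂ] H)) {a : A} (ha : IsSelfAdjoint a)
    (hc : IsCompactOperator (ρ a)) {ε : ℝ} (hε : 0 < ε) :
    FiniteDimensional ℂ (LinearMap.range (ρ (cfcₙ (cut (2 * ε)) a) : H →ₗ[ℂ] H)) := by
  obtain ⟨c, hac⟩ := exists_step_eq_mul ha hε
  set s := cfcₙ (step ε) a with hs
  set b := cfcₙ (cut (2 * ε)) a with hb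
  have hsb : s * b = b := cfcₙ_step_mul_cut a hε
  have hsc : IsCompactOperator (ρ s) := by
    rw [hac, map_mul]
    exact hc.comp_clm (ρ c)
  -- The fixed space of the compact `ρ s` contains the range of `ρ b`, and compactness of the
  -- identity on it bounds its dimension.
  let V : Submodule ℂ H := LinearMap.ker ((ρ s : H →ₗ[ℂ] H) - LinearMap.id)
  have hV : ∀ v, v ∈ V ↔ ρ s v = v := fun v => by simp [V, sub_eq_zero]
  have hVc : IsClosed (V : Set H) := by
    have : (V : Set H) = {v | ρ s v = v} := by ext v; exact hV v
    rw [this]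
    exact isClosed_eq (ρ s).continuous continuous_id
  have hmaps : ∀ v ∈ V, (ρ s : H →ₗ[ℂ] H) v ∈ V := fun v hv => by
    have := (hV v).1 hv
    simpa [this] using hv
  have hr : IsCompactOperator ((ρ s : H →ₗ[ℂ] H).restrict hmaps) :=
    IsCompactOperator.restrict (f := (ρ s : H →ₗ[ℂ] H)) hsc hmaps hVc
  have hid : ((ρ s : H →ₗ[ℂ] H).restrict hmaps : V → V) = id := by
    funext v
    exact Subtype.ext ((hV v).1 v.2)
  rw [hid] at hr
  have : FiniteDimensional ℂ V := FiniteDimensional.of_isCompactOperator_id hr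
  refine Submodule.finiteDimensional_of_le (S₂ := V) ?_
  rintro _ ⟨v, rfl⟩
  rw [hV]
  change ρ s (ρ b v) = ρ b v
  rw [← mul_apply_eq_comp, ← map_mul, hsb]

/-- The compressions `b k b` form an algebra on the finite-dimensional range, and Burnside applies.
For transitivity: `ρ b` is self-adjoint, hence injective on its range; a nonzero vector there has a
dense orbit, and its image under `ρ b` is a subspace dense in the range, hence equal to it. -/
theorem exists_compression {ρ : A →⋆ₙₐ[ℂ] (H →L[ℂ] H)} (hρ : IsIrreducible ρ) {b : A}
    (hb : IsSelfAdjoint b) [FiniteDimensional ℂ (LinearMap.range (ρ b : H →ₗ[ℂ] H))]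
    (F : Module.End ℂ (LinearMap.range (ρ b : H →ₗ[ℂ] H))) :
    ∃ k : A, ∀ v : LinearMap.range (ρ b : H →ₗ[ℂ] H), ρ (b * k * b) v = F v := by
  have hsymm : ∀ x y : H, inner ℂ (ρ b x) y = inner ℂ x (ρ b y) := by
    intro x y
    have : IsSelfAdjoint (ρ b) := hb.map ρ
    rw [ContinuousLinearMap.isSelfAdjoint_iff_isSymmetric] at this
    exact this x y
  let B : Submodule ℂ (Module.End ℂ (LinearMap.range (ρ b : H →ₗ[ℂ] H))) :=
    { carrier := {f | ∃ k : A, ∀ v : LinearMap.range (ρ b : H →ₗ[ℂ] H), ρ (b * k * b) v = f v}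
      add_mem' := by
        rintro f g ⟨k, hk⟩ ⟨l, hl⟩
        refine ⟨k + l, fun v => ?_⟩
        rw [mul_add, add_mul, map_add, add_apply, hk, hl]
        rfl
      zero_mem' := ⟨0, fun v => by simp⟩
      smul_mem' := by
        rintro c f ⟨k, hk⟩
        refine ⟨c • k, fun v => ?_⟩
        rw [mul_smul_comm, smul_mul_assoc, map_smul, smul_apply, hk]
        rfl }
  have hB : B = ⊤ := by
    refine eq_top_of_transitive B ?_ ?_
    · rintro f ⟨k, hk⟩ g ⟨l, hl⟩
      refine ⟨k * b * b * l, fun v => ?_⟩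
      have : b * (k * b * b * l) * b = (b * k * b) * (b * l * b) := by simp only [mul_assoc]
      rw [this, map_mul, mul_apply_eq_comp, hl, hk]
      rfl
    · intro v hv w
      have hTv : ρ b v ≠ 0 := by
        intro h0
        obtain ⟨u, hu⟩ := v.2
        apply hv
        rw [← Submodule.coe_eq_zero, ← inner_self_eq_zero (𝕜 := ℂ)]
        nth_rewrite 1 [← hu]
        change inner ℂ (ρ b u) (v : H) = 0
        rw [hsymm, h0, inner_zero_right]
      let L : A →ₗ[ℂ] H :=
        { toFun := fun k => ρ (b * k * b) v
          map_add' := fun k l => by rw [mul_add, add_mul, map_add]; rfl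
          map_smul' := fun c k => by rw [mul_smul_comm, smul_mul_assoc, map_smul]; rfl }
      have hLle : LinearMap.range L ≤ LinearMap.range (ρ b : H →ₗ[ℂ] H) := by
        rintro _ ⟨k, rfl⟩
        exact ⟨ρ (k * b) v, by simp [L, mul_assoc]⟩
      have hfin : FiniteDimensional ℂ (LinearMap.range L) := Submodule.finiteDimensional_of_le hLle
      have hclosed : IsClosed (LinearMap.range L : Set H) := Submodule.closed_of_finiteDimensional _
      have hw : (w : H) ∈ LinearMap.range L := by
        obtain ⟨u, hu⟩ := w.2
        rw [← hu, ← SetLike.mem_coe, ← hclosed.closure_eq]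
        refine map_mem_closure (ρ b).continuous (hρ.dense_range hTv u) ?_
        rintro _ ⟨k, rfl⟩
        exact ⟨k, by simp [L]⟩
      obtain ⟨k, hk⟩ := hw
      refine ⟨LinearMap.codRestrict _ ((ρ (b * k * b) : H →ₗ[ℂ] H) ∘ₗ Submodule.subtype _)
        (fun x => ⟨ρ (k * b) x, by simp [mul_assoc]⟩), ⟨k, fun x => rfl⟩, Subtype.ext hk⟩
  have : F ∈ B := hB ▸ Submodule.mem_top
  exact this

theorem cfcₙ_ne_zero_of_eigenvector {T : H →L[ℂ] H} (hT : IsSelfAdjoint T) {v : H} (hv : v ≠ 0)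
    {l : ℝ} (hl : T v = (l : ℂ) • v) {f : ℝ → ℝ} (hf : Continuous f) (h0 : f 0 = 0)
    (hfl : f l ≠ 0) : cfcₙ f T ≠ 0 := by
  intro h
  rw [← cfcₙ_zero ℝ T] at h
  have hmem : l ∈ quasispectrum ℝ T := by
    rw [quasispectrum_eq_spectrum_union_zero]
    refine Or.inl fun hu => hv ?_
    obtain ⟨S, hS⟩ := hu
    have h1 : (S : H →L[ℂ] H) v = 0 := by
      rw [hS, sub_apply, hl, Algebra.algebraMap_eq_smul_one]
      simp
    have h2 : ((S⁻¹ : (H →L[ℂ] H)ˣ) : H →L[ℂ] H) ((S : H →L[ℂ] H) v) = v := by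
      rw [← mul_apply_eq_comp, Units.inv_mul, one_apply_eq_self]
    rw [← h2, h1, map_zero]
  exact hfl (eqOn_of_cfcₙ_eq_cfcₙ h hT hf.continuousOn h0 continuousOn_const rfl hmem)

/-- A continuous function supported in the closed ball of radius `1 / 2` about `l`. -/
noncomputable def bump (l t : ℝ) : ℝ := max (1 / 2 - |t - l|) 0

theorem continuous_bump (l : ℝ) : Continuous (bump l) := by unfold bump; fun_prop

theorem bump_mul_bump {l m : ℝ} (h : 1 ≤ |l - m|) (t : ℝ) : bump l t * bump m t = 0 := by
  by_contra hne
  have h1 : 0 < 1 / 2 - |t - l| := by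
    by_contra! hle
    exact hne (by rw [bump, max_eq_right hle, zero_mul])
  have h2 : 0 < 1 / 2 - |t - m| := by
    by_contra! hle
    exact hne (by rw [mul_comm, bump, max_eq_right hle, zero_mul])
  have := abs_sub_le l t m
  rw [abs_sub_comm l t] at this
  linarith

/-- A finite rank operator `ρ(b)`, `b` self-adjoint, of rank `N` gives `N` orthogonal elements in
the right ideal generated by `b` which are nonzero under `ρ`. -/
theorem exists_orthogonal {ρ : A →⋆ₙₐ[ℂ] (H →L[ℂ] H)} (hρ : IsIrreducible ρ) {b : A}
    (hb : IsSelfAdjoint b) [FiniteDimensional ℂ (LinearMap.range (ρ b : H →ₗ[ℂ] H))] :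
    ∃ d : Fin (Module.finrank ℂ (LinearMap.range (ρ b : H →ₗ[ℂ] H))) → A,
      (∀ i, IsSelfAdjoint (d i)) ∧ (∀ i, ∃ x, d i = b * x) ∧ (∀ i, ρ (d i) ≠ 0) ∧
        ∀ i j, i ≠ j → d i * d j = 0 := by
  let e := stdOrthonormalBasis ℂ (LinearMap.range (ρ b : H →ₗ[ℂ] H))
  -- Prescribed eigenvalues `1, …, N` are at distance at least `1` from each other and from `0`. So
  -- bumps of radius `1 / 2` around them have product zero and vanish near `0`.
  obtain ⟨k, hk⟩ := exists_compression hρ hb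
    (e.toBasis.constr ℂ fun i => (((i : ℕ) + 1 : ℝ) : ℂ) • e i)
  set h₀ := b * k * b with hh₀
  have h1 : ∀ i, ρ h₀ (e i) = (((i : ℕ) + 1 : ℝ) : ℂ) • (e i : H) := by
    intro i
    rw [hk]
    have := e.toBasis.constr_basis ℂ (fun i => (((i : ℕ) + 1 : ℝ) : ℂ) • e i) i
    rw [OrthonormalBasis.coe_toBasis] at this
    rw [this]
    rfl
  -- `star h₀` also preserves the range, and there it is the adjoint of a real diagonal operator.
  -- Hence symmetrising `h₀` keeps the eigenvectors.
  have h2 : ∀ i, ρ (star h₀) (e i) = (((i : ℕ) + 1 : ℝ) : ℂ) • (e i : H) := by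
    intro i
    have hmem : ρ (star h₀) (e i) ∈ LinearMap.range (ρ b : H →ₗ[ℂ] H) := by
      refine ⟨ρ (star k * b) (e i), ?_⟩
      rw [hh₀, star_mul, star_mul, hb.star_eq]
      simp
    have : (⟨_, hmem⟩ : LinearMap.range (ρ b : H →ₗ[ℂ] H)) = (((i : ℕ) + 1 : ℝ) : ℂ) • e i := by
      refine InnerProductSpace.ext_inner_left_basis e.toBasis fun j => ?_
      rw [OrthonormalBasis.coe_toBasis, Submodule.coe_inner]
      change inner ℂ (e j : H) (ρ (star h₀) (e i)) = _
      rw [map_star, ContinuousLinearMap.star_eq_adjoint, ContinuousLinearMap.adjoint_inner_right, h1,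
        inner_smul_left, inner_smul_right, Complex.conj_ofReal, ← Submodule.coe_inner,
        orthonormal_iff_ite.1 e.orthonormal]
      split_ifs with hij
      · rw [hij]
      · simp
    exact congrArg Subtype.val this
  set h : A := (2⁻¹ : ℂ) • (h₀ + star h₀) with hh
  have hsa : IsSelfAdjoint h := by
    rw [IsSelfAdjoint, hh, star_smul, star_add, star_star, add_comm]
    simp
  have hmul : ∃ y, h = b * y :=
    ⟨(2⁻¹ : ℂ) • (k * b + star k * b), by
      rw [hh, hh₀, star_mul, star_mul, hb.star_eq, mul_smul_comm, mul_add]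
      simp only [mul_assoc]⟩
  obtain ⟨y, hy⟩ := hmul
  have heig : ∀ i, ρ h (e i) = (((i : ℕ) + 1 : ℝ) : ℂ) • (e i : H) := by
    intro i
    rw [hh, map_smul, map_add, smul_apply, add_apply,
      h1, h2, ← two_smul ℂ, smul_smul]
    norm_num
  have hzero : ∀ (i : ℕ) (t : ℝ), |t| ≤ 1 / 2 → bump ((i : ℝ) + 1) t = 0 := by
    intro i t ht
    refine max_eq_right ?_
    have h3 := neg_le_abs (t - ((i : ℝ) + 1))
    have h4 := le_abs_self t
    have h5 : (0 : ℝ) ≤ i := i.cast_nonneg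
    linarith
  refine ⟨fun i => cfcₙ (bump ((i : ℕ) + 1)) h, fun i => cfcₙ_predicate _ _, fun i => ?_,
    fun i => ?_, fun i j hij => ?_⟩
  · obtain ⟨c, hc⟩ := exists_cfcₙ_eq_mul hsa (continuous_bump ((i : ℕ) + 1))
      (by norm_num : (0 : ℝ) < 1 / 2) (hzero i)
    refine ⟨y * c, ?_⟩
    change cfcₙ _ h = _
    rw [hc, ← mul_assoc, ← hy]
  · have hz : bump ((i : ℕ) + 1) 0 = 0 := hzero i 0 (by norm_num)
    rw [NonUnitalStarAlgHom.map_cfcₙ ρ (bump ((i : ℕ) + 1)) h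
      (continuous_bump _).continuousOn hz (continuous_representation ρ) hsa (hsa.map ρ)]
    refine cfcₙ_ne_zero_of_eigenvector (hsa.map ρ) (v := e i) ?_ (heig i) (continuous_bump _) hz ?_
    · have := e.orthonormal.ne_zero i
      simpa using this
    · norm_num [bump]
  · change cfcₙ _ h * cfcₙ _ h = 0
    rw [← cfcₙ_mul _ _ h (continuous_bump _).continuousOn (hzero i 0 (by norm_num))
      (continuous_bump _).continuousOn (hzero j 0 (by norm_num))]
    have hd : (1 : ℝ) ≤ |((i : ℕ) + 1 : ℝ) - ((j : ℕ) + 1)| := by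
      have : ((i : ℕ) : ℤ) - ((j : ℕ) : ℤ) ≠ 0 := by
        intro h0
        exact hij (Fin.ext (by omega))
      have h3 := Int.one_le_abs this
      have h4 : ((i : ℕ) + 1 : ℝ) - ((j : ℕ) + 1) = ((((i : ℕ) : ℤ) - ((j : ℕ) : ℤ) : ℤ) : ℝ) := by
        push_cast; ring
      rw [h4]
      exact_mod_cast h3
    simp only [bump_mul_bump hd]
    exact cfcₙ_const_zero ℝ h

/-- Orthogonal self-adjoint elements have orthogonal ranges, all inside the range of `σ b`; pick a
nonzero vector in each. Irreducibility plays no part, so the bound transfers to other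
representations. -/
theorem natCast_le_operatorRank (σ : A →⋆ₙₐ[ℂ] (H →L[ℂ] H)) {b : A} {N : ℕ} {d : Fin N → A}
    (hsa : ∀ i, IsSelfAdjoint (d i)) (hd : ∀ i, ∃ x, d i = b * x) (hne : ∀ i, σ (d i) ≠ 0)
    (horth : ∀ i j, i ≠ j → d i * d j = 0) : (N : ℕ∞) ≤ operatorRank (σ b) := by
  have hex : ∀ i, ∃ v, σ (d i) v ≠ 0 := by
    intro i
    by_contra! h
    exact hne i (ContinuousLinearMap.ext h)
  choose v hv using hex
  choose x hx using hd
  have hmem : ∀ i, σ (d i) (v i) ∈ LinearMap.range (σ b : H →ₗ[ℂ] H) := by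
    intro i
    rw [hx i, map_mul]
    exact ⟨σ (x i) (v i), rfl⟩
  have hli : LinearIndependent ℂ fun i => σ (d i) (v i) := by
    refine linearIndependent_of_ne_zero_of_inner_eq_zero hv fun i j hij => ?_
    have : IsSelfAdjoint (σ (d i)) := (hsa i).map σ
    rw [ContinuousLinearMap.isSelfAdjoint_iff_isSymmetric] at this
    have h1 : inner ℂ (σ (d i) (v i)) (σ (d j) (v j)) = inner ℂ (v i) (σ (d i) (σ (d j) (v j))) :=
      this _ _
    change inner ℂ (σ (d i) (v i)) (σ (d j) (v j)) = 0
    rw [h1, ← mul_apply_eq_comp, ← map_mul, horth i j hij]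
    simp
  have hli' : LinearIndependent ℂ
      fun i => (⟨_, hmem i⟩ : LinearMap.range (σ b : H →ₗ[ℂ] H)) :=
    LinearIndependent.of_comp (Submodule.subtype _) hli
  rw [operatorRank, Cardinal.natCast_le_toENat]
  simpa [LinearMap.rank] using hli'.cardinal_lift_le_rank

end FiniteRank

/-! ### Finiteness and lower semicontinuity of the Pedersen function. -/

section PedersenFunction

variable {A : Type u} [NonUnitalCStarAlgebra A]

theorem isClosed_iff_exists_hull {C : Set (Prim A)} :
    IsClosed C ↔ ∃ I : Submodule ℂ A, IsClosedIdeal I ∧ C = hull I := by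
  rw [← isOpen_compl_iff]
  change Cᶜᶜ ∈ {C : Set (Prim A) | ∃ I : Submodule ℂ A, IsClosedIdeal I ∧ C = hull I} ↔ _
  rw [compl_compl]
  rfl

theorem isOpen_setOf_notMem (d : A) : IsOpen {P : Prim A | d ∉ P.1} := by
  rw [← isClosed_compl_iff, isClosed_iff_exists_hull]
  refine ⟨closedIdealSpan {d}, closedIdealSpan_isClosedIdeal _, ?_⟩
  ext P
  simp only [Set.mem_compl_iff, Set.mem_ofPred_eq, not_not]
  constructor
  · exact fun h => closedIdealSpan_le P.2.isClosedIdeal (Set.singleton_subset_iff.2 h)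
  · exact fun h => h (subset_closedIdealSpan _ rfl)

variable (A) in
/-- The elements of finite rank in every irreducible representation. -/
def HasFiniteRank (b : A) : Prop :=
  ∀ (H : Type u) [NormedAddCommGroup H] [InnerProductSpace ℂ H] [CompleteSpace H]
    (ρ : A →⋆ₙₐ[ℂ] (H →L[ℂ] H)), IsIrreducible ρ → operatorRank (ρ b) < ⊤

theorem operatorRank_le_pedersenFunction {H : Type u} [NormedAddCommGroup H]
    [InnerProductSpace ℂ H] [CompleteSpace H] {ρ : A →⋆ₙₐ[ℂ] (H →L[ℂ] H)} (hρ : IsIrreducible ρ)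
    {P : Prim A} (hP : kernel ρ = P.1) (b : A) : operatorRank (ρ b) ≤ pedersenFunction b P :=
  le_sSup ⟨H, _, _, _, ρ, hρ, hP, rfl⟩

theorem exists_operatorRank_ge {b : A} {P : Prim A} {N : ℕ} (hN : N ≤ pedersenFunction b P) :
    ∃ (H : Type u) (_ : NormedAddCommGroup H) (_ : InnerProductSpace ℂ H) (_ : CompleteSpace H)
      (ρ : A →⋆ₙₐ[ℂ] (H →L[ℂ] H)), IsIrreducible ρ ∧ kernel ρ = P.1 ∧ N ≤ operatorRank (ρ b) := by
  rcases N with _ | m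
  · obtain ⟨H, _, _, _, ρ, hρ, hP⟩ := P.2
    exact ⟨H, _, _, _, ρ, hρ, hP, by simp⟩
  · have hm : (m : ℕ∞) < pedersenFunction b P :=
      lt_of_lt_of_le (by exact_mod_cast Nat.lt_succ_self m) hN
    obtain ⟨_, ⟨H, _, _, _, ρ, hρ, hP, rfl⟩, hlt⟩ := lt_sSup_iff.1 hm
    refine ⟨H, _, _, _, ρ, hρ, hP, ?_⟩
    push_cast
    exact Order.add_one_le_of_lt hlt

/-- The rank bound is witnessed by finitely many elements lying outside `P`, an open condition on
the primitive ideal. It holds for every representation with the given kernel, so unitary equivalence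
of these is never needed. -/
theorem HasFiniteRank.exists_notMem {b : A} (hfin : HasFiniteRank A b) (hb : IsSelfAdjoint b)
    {P : Prim A} {N : ℕ} (hN : N ≤ pedersenFunction b P) :
    ∃ (M : ℕ) (d : Fin M → A), N ≤ M ∧ (∀ i, d i ∉ P.1) ∧
      ∀ Q : Prim A, (∀ i, d i ∉ Q.1) → ∀ (H : Type u) [NormedAddCommGroup H]
        [InnerProductSpace ℂ H] [CompleteSpace H] (σ : A →⋆ₙₐ[ℂ] (H →L[ℂ] H)),
        kernel σ = Q.1 → (M : ℕ∞) ≤ operatorRank (σ b) := by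
  obtain ⟨H, _, _, _, ρ, hρ, hP, hle⟩ := exists_operatorRank_ge hN
  have hfd := finiteDimensional_of_operatorRank_lt_top (hfin H ρ hρ)
  obtain ⟨d, hsa, hd, hne, horth⟩ := exists_orthogonal hρ hb
  refine ⟨_, d, ?_, fun i => ?_, ?_⟩
  · rw [operatorRank_eq_finrank hfd] at hle
    exact_mod_cast hle
  · rw [← hP]
    exact hne i
  · intro Q hQ H' _ _ _ σ hσ
    refine natCast_le_operatorRank σ hsa hd (fun i => ?_) horth
    have := hQ i
    rwa [← hσ] at this

theorem HasFiniteRank.pedersenFunction_lt_top {b : A} (hfin : HasFiniteRank A b)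
    (hb : IsSelfAdjoint b) (P : Prim A) : pedersenFunction b P < ⊤ := by
  obtain ⟨H, _, _, _, ρ, hρ, hP⟩ := P.2
  have hfd := finiteDimensional_of_operatorRank_lt_top (hfin H ρ hρ)
  by_contra hcon
  rw [not_lt_top_iff] at hcon
  -- An infinite supremum would give witnesses for one more than the rank at `ρ`; evaluating them at
  -- `ρ` itself is absurd.
  obtain ⟨M, d, hNM, hd, hQ⟩ := hfin.exists_notMem hb (P := P)
    (N := Module.finrank ℂ (LinearMap.range (ρ b : H →ₗ[ℂ] H)) + 1) (hcon ▸ le_top)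
  have := hQ P hd H ρ hP
  rw [operatorRank_eq_finrank hfd] at this
  have h2 : M ≤ Module.finrank ℂ (LinearMap.range (ρ b : H →ₗ[ℂ] H)) := by exact_mod_cast this
  omega

theorem HasFiniteRank.isClosed_setOf_le {b : A} (hfin : HasFiniteRank A b)
    (hb : IsSelfAdjoint b) (n : ℕ) : IsClosed {P : Prim A | pedersenFunction b P ≤ n} := by
  rw [← isOpen_compl_iff, isOpen_iff_forall_mem_open]
  intro P hP
  have hP' : (n : ℕ∞) < pedersenFunction b P := not_le.1 hP
  obtain ⟨M, d, hNM, hd, hQ⟩ := hfin.exists_notMem hb (P := P) (N := n + 1) (by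
    push_cast
    exact Order.add_one_le_of_lt hP')
  refine ⟨⋂ i, {Q : Prim A | d i ∉ Q.1}, ?_, isOpen_iInter_of_finite fun i =>
    isOpen_setOf_notMem (d i), Set.mem_iInter.2 hd⟩
  intro Q hdQ
  obtain ⟨H, _, _, _, σ, hσ, hker⟩ := Q.2
  have h1 := hQ Q (Set.mem_iInter.1 hdQ) H σ hker
  have h2 := operatorRank_le_pedersenFunction hσ hker b
  have h3 : (n : ℕ∞) < M := by exact_mod_cast hNM
  exact not_le.2 (h3.trans_le (h1.trans h2))

end PedersenFunction

/-! ### Quasi-states and the GNS construction. -/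

section States

variable {A : Type u} [NonUnitalCStarAlgebra A]

variable (A) in
/-- The positive functionals of norm at most `1`, described by the Cauchy-Schwarz inequality. -/
def quasiStates : Set (WeakDual ℂ A) :=
  {φ | (∀ x, ‖φ x‖ ≤ ‖x‖) ∧ ∀ x, ‖φ x‖ ^ 2 ≤ (φ (star x * x)).re ∧ (φ (star x * x)).im = 0}

/-- The quasi-states which vanish on `J` and take the value `1` on the sequence `a`. -/
def quasiStatesOn (J : Submodule ℂ A) (a : ℕ → A) : Set (WeakDual ℂ A) :=
  {φ | φ ∈ quasiStates A ∧ (∀ x ∈ J, φ x = 0) ∧ ∀ n, φ (a n) = 1}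

theorem isCompact_quasiStates : IsCompact (quasiStates A) := by
  refine WeakDual.isCompact_of_bounded_of_closed ?_ ?_
  · refine (WeakDual.isBounded_closedBall 0 1).subset fun φ hφ => ?_
    rw [Set.mem_preimage, mem_closedBall_zero_iff]
    exact ContinuousLinearMap.opNorm_le_bound _ zero_le_one fun x => by
      rw [one_mul]; exact hφ.1 x
  · have hc : ∀ x : A, Continuous fun φ : WeakDual ℂ A => φ x := WeakDual.eval_continuous
    refine IsClosed.and ?_ ?_
    · rw [Set.ofPred_forall]
      exact isClosed_iInter fun x => isClosed_le (hc x).norm continuous_const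
    · rw [Set.ofPred_forall]
      refine isClosed_iInter fun x => IsClosed.and ?_ ?_
      · exact isClosed_le ((hc x).norm.pow 2) (Complex.continuous_re.comp (hc _))
      · exact isClosed_eq (Complex.continuous_im.comp (hc _)) continuous_const

theorem isClosed_setOf_vanish (J : Submodule ℂ A) :
    IsClosed {φ : WeakDual ℂ A | ∀ x ∈ J, φ x = 0} := by
  simp only [Set.ofPred_forall]
  exact isClosed_biInter fun x _ => isClosed_eq (WeakDual.eval_continuous x) continuous_const

theorem isClosed_setOf_eq_one (a : A) : IsClosed {φ : WeakDual ℂ A | φ a = 1} :=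
  isClosed_eq (WeakDual.eval_continuous a) continuous_const

theorem isCompact_quasiStatesOn (J : Submodule ℂ A) (a : ℕ → A) :
    IsCompact (quasiStatesOn J a) := by
  refine isCompact_quasiStates.inter_right ?_
  refine IsClosed.and (isClosed_setOf_vanish J) ?_
  rw [Set.ofPred_forall]
  exact isClosed_iInter fun n => isClosed_setOf_eq_one (a n)

/-- By compactness, `quasiStatesOn J a` is nonempty if this holds for the finite parts of `a`. -/
theorem quasiStatesOn_nonempty (J : Submodule ℂ A) (a : ℕ → A)
    (h : ∀ n, ∃ φ ∈ quasiStates A, (∀ x ∈ J, φ x = 0) ∧ ∀ k ≤ n, φ (a k) = 1) :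
    (quasiStatesOn J a).Nonempty := by
  let t : ℕ → Set (WeakDual ℂ A) := fun n =>
    {φ | φ ∈ quasiStates A ∧ (∀ x ∈ J, φ x = 0) ∧ ∀ k ≤ n, φ (a k) = 1}
  have hcl : ∀ n, IsClosed {φ : WeakDual ℂ A | (∀ x ∈ J, φ x = 0) ∧ ∀ k ≤ n, φ (a k) = 1} := by
    intro n
    refine IsClosed.and (isClosed_setOf_vanish J) ?_
    simp only [Set.ofPred_forall]
    exact isClosed_biInter fun k _ => isClosed_setOf_eq_one (a k)
  have hcomp : ∀ n, IsCompact (t n) := fun n => isCompact_quasiStates.inter_right (hcl n)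
  obtain ⟨φ, hφ⟩ := IsCompact.nonempty_iInter_of_sequence_nonempty_isCompact_isClosed t
    (fun n φ hφ => ⟨hφ.1, hφ.2.1, fun k hk => hφ.2.2 k (hk.trans n.le_succ)⟩)
    (fun n => h n) (hcomp 0) (fun n => (hcomp n).isClosed)
  rw [Set.mem_iInter] at hφ
  exact ⟨φ, (hφ 0).1, (hφ 0).2.1, fun n => (hφ n).2.2 n le_rfl⟩

section VectorFunctional

variable {H : Type u} [NormedAddCommGroup H] [InnerProductSpace ℂ H] [CompleteSpace H]

/-- The functional `x ↦ ⟪ξ, π(x) ξ⟫`. -/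
noncomputable def vectorFunctional (π : A →⋆ₙₐ[ℂ] (H →L[ℂ] H)) (ξ : H) : WeakDual ℂ A :=
  StrongDual.toWeakDual <| LinearMap.mkContinuous
    { toFun := fun x => inner ℂ ξ (π x ξ)
      map_add' := fun x y => by rw [map_add, add_apply, inner_add_right]
      map_smul' := fun c x => by
        rw [map_smul, smul_apply, inner_smul_right]; rfl } (‖ξ‖ * ‖ξ‖) fun x => by
    refine (norm_inner_le_norm _ _).trans ?_
    rw [mul_assoc]
    refine mul_le_mul_of_nonneg_left ?_ (norm_nonneg _)
    rw [mul_comm]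
    exact (π x).le_of_opNorm_le (NonUnitalStarAlgHom.norm_apply_le π x) ξ

theorem vectorFunctional_apply (π : A →⋆ₙₐ[ℂ] (H →L[ℂ] H)) (ξ : H) (x : A) :
    vectorFunctional π ξ x = inner ℂ ξ (π x ξ) := rfl

theorem inner_representation (π : A →⋆ₙₐ[ℂ] (H →L[ℂ] H)) (x : A) (u v : H) :
    inner ℂ (π x u) v = inner ℂ u (π (star x) v) := by
  rw [map_star, ContinuousLinearMap.star_eq_adjoint, ContinuousLinearMap.adjoint_inner_right]

theorem vectorFunctional_star_mul_self (π : A →⋆ₙₐ[ℂ] (H →L[ℂ] H)) (ξ : H) (x : A) :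
    vectorFunctional π ξ (star x * x) = ((‖π x ξ‖ ^ 2 : ℝ) : ℂ) := by
  rw [vectorFunctional_apply, map_mul, mul_apply_eq_comp, ← inner_representation,
    inner_self_eq_norm_sq_to_K]
  norm_cast

theorem vectorFunctional_mem_quasiStates (π : A →⋆ₙₐ[ℂ] (H →L[ℂ] H)) {ξ : H} (hξ : ‖ξ‖ ≤ 1) :
    vectorFunctional π ξ ∈ quasiStates A := by
  have h1 : ∀ x, ‖vectorFunctional π ξ x‖ ≤ ‖π x ξ‖ := fun x => by
    rw [vectorFunctional_apply]
    exact (norm_inner_le_norm _ _).trans (mul_le_of_le_one_left (norm_nonneg _) hξ)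
  refine ⟨fun x => ?_, fun x => ?_⟩
  · refine (h1 x).trans ?_
    have h2 := (π x).le_of_opNorm_le (NonUnitalStarAlgHom.norm_apply_le π x) ξ
    exact h2.trans (mul_le_of_le_one_right (norm_nonneg _) hξ)
  · rw [vectorFunctional_star_mul_self, Complex.ofReal_re, Complex.ofReal_im]
    exact ⟨pow_le_pow_left₀ (norm_nonneg _) (h1 x) 2, rfl⟩

end VectorFunctional

open scoped ComplexOrder in
/-- The GNS representation of a quasi-state. -/
theorem exists_gns {φ : WeakDual ℂ A} (hφ : φ ∈ quasiStates A) :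
    ∃ (H : Type u) (_ : NormedAddCommGroup H) (_ : InnerProductSpace ℂ H) (_ : CompleteSpace H)
      (π : A →⋆ₙₐ[ℂ] (H →L[ℂ] H)) (ξ : H), ‖ξ‖ ≤ 1 ∧ (Dense (Set.range fun x : A => π x ξ)) ∧
        φ = vectorFunctional π ξ := by
  let _ := CStarAlgebra.spectralOrder A
  have := CStarAlgebra.spectralOrderedRing A
  let f : A →ₚ[ℂ] ℂ := PositiveLinearMap.mk₀ (φ : A →ₗ[ℂ] ℂ) (by
    intro x hx
    obtain ⟨y, rfl⟩ := CStarAlgebra.nonneg_iff_eq_star_mul_self.1 hx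
    rw [Complex.nonneg_iff]
    exact ⟨(sq_nonneg _).trans (hφ.2 y).1, (hφ.2 y).2.symm⟩)
  let π := f.gnsNonUnitalStarAlgHom
  let ι : A → f.GNS := fun x => ((f.toPreGNS x : f.PreGNS) : f.GNS)
  have hinner : ∀ x y, inner ℂ (ι x) (ι y) = φ (star x * y) := fun x y => by
    rw [UniformSpace.Completion.inner_coe, f.preGNS_inner_def]
    rfl
  have hπ : ∀ x y, π x (ι y) = ι (x * y) := fun x y => by
    simp [π, ι]
  have hdense : DenseRange ι :=
    UniformSpace.Completion.denseRange_coe.comp f.toPreGNS.surjective.denseRange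
      (UniformSpace.Completion.continuous_coe _)
  -- By the Cauchy-Schwarz condition `φ` is itself bounded on the GNS space. Its Riesz vector serves
  -- as cyclic vector, replacing the class of the unit.
  let ℓ : f.PreGNS →L[ℂ] ℂ := LinearMap.mkContinuous ((φ : A →ₗ[ℂ] ℂ) ∘ₗ f.ofPreGNS.toLinearMap) 1
    (by
      intro x
      rw [one_mul, f.preGNS_norm_def]
      exact Real.le_sqrt_of_sq_le (hφ.2 (f.ofPreGNS x)).1)
  have hℓ : ∀ x, ‖ℓ x‖ ≤ ‖x‖ := fun x => by
    rw [f.preGNS_norm_def]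
    exact Real.le_sqrt_of_sq_le (hφ.2 (f.ofPreGNS x)).1
  let L : f.GNS →L[ℂ] ℂ := ℓ.extend (UniformSpace.Completion.toComplL (𝕜 := ℂ))
  have hL : ∀ x : f.PreGNS, L x = ℓ x := fun x =>
    ContinuousLinearMap.extend_eq ℓ (e := UniformSpace.Completion.toComplL (𝕜 := ℂ))
      UniformSpace.Completion.denseRange_coe
      (UniformSpace.Completion.isUniformInducing_coe _) x
  have hLle : ∀ z, ‖L z‖ ≤ ‖z‖ := by
    intro z
    induction z using UniformSpace.Completion.induction_on with
    | hp => exact isClosed_le (by fun_prop) (by fun_prop)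
    | ih x =>
      rw [hL, UniformSpace.Completion.norm_coe]
      exact hℓ x
  let ξ : f.GNS := (InnerProductSpace.toDual ℂ f.GNS).symm L
  have hξ : ∀ z, inner ℂ ξ z = L z := fun z => InnerProductSpace.toDual_symm_apply
  have hξι : ∀ x, inner ℂ ξ (ι x) = φ x := fun x => by rw [hξ, hL]; rfl
  have hcyc : ∀ x, π x ξ = ι x := by
    intro x
    refine hdense.eq_of_inner_left ℂ ?_
    intro y
    rw [inner_representation, hπ, hξι, hinner]
  refine ⟨f.GNS, inferInstance, inferInstance, inferInstance, π, ξ, ?_, ?_, ?_⟩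
  · have h1 := hLle ξ
    rw [← hξ, inner_self_eq_norm_sq_to_K] at h1
    have h2 : ‖ξ‖ ^ 2 ≤ ‖ξ‖ := by simpa using h1
    nlinarith [norm_nonneg ξ]
  · simp only [hcyc]
    exact hdense
  · refine DFunLike.ext _ _ fun x => ?_
    rw [vectorFunctional_apply, hcyc, hξι]

end States

/-! ### Extreme quasi-states and primitive ideals. -/

section PurePoint

variable {A : Type u} [NonUnitalCStarAlgebra A]

/-- The GNS representation of an extreme point of `quasiStatesOn J a` is irreducible. -/
theorem isIrreducible_of_extreme {H : Type u} [NormedAddCommGroup H] [InnerProductSpace ℂ H]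
    [CompleteSpace H] {π : A →⋆ₙₐ[ℂ] (H →L[ℂ] H)} {ξ : H} (hξ : ‖ξ‖ ≤ 1)
    (hd : Dense (Set.range fun x : A => π x ξ)) {J : Submodule ℂ A} (hJ : ∀ x ∈ J, π x = 0)
    {a : ℕ → A} (ha : ∀ n, ‖a n‖ ≤ 1)
    (hext : vectorFunctional π ξ ∈ (quasiStatesOn J a).extremePoints ℝ) : IsIrreducible π := by
  obtain ⟨⟨hq, -, hone⟩, hextr⟩ := mem_extremePoints.1 hext
  have hle : ∀ (n : ℕ) (η : H), ‖(inner ℂ η (π (a n) η) : ℂ)‖ ≤ ‖η‖ ^ 2 := by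
    intro n η
    refine (norm_inner_le_norm _ _).trans ?_
    rw [sq]
    refine mul_le_mul_of_nonneg_left ?_ (norm_nonneg _)
    have h1 := (π (a n)).le_of_opNorm_le
      ((NonUnitalStarAlgHom.norm_apply_le π (a n)).trans (ha n)) η
    rwa [one_mul] at h1
  have hnorm : ‖ξ‖ = 1 := by
    refine le_antisymm hξ ?_
    have h1 := hle 0 ξ
    rw [← vectorFunctional_apply, hone 0, norm_one] at h1
    nlinarith [norm_nonneg ξ]
  refine ⟨⟨a 0, fun h0 => ?_⟩, fun L hL hinv => ?_⟩
  · have h1 := hone 0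
    rw [vectorFunctional_apply, h0] at h1
    simp at h1
  have htop : ∀ M : Submodule ℂ H, IsClosed (M : Set H) → (∀ x, ∀ v ∈ M, π x v ∈ M) → ξ ∈ M →
      M = ⊤ := by
    intro M hM hMinv hξM
    rw [eq_top_iff]
    intro v _
    rw [← SetLike.mem_coe, ← hM.closure_eq]
    refine closure_mono ?_ (hd v)
    rintro _ ⟨x, rfl⟩
    exact hMinv x ξ hξM
  have hcomplete : CompleteSpace L := hL.completeSpace_coe
  have hinv' : ∀ x, ∀ v ∈ Lᗮ, π x v ∈ Lᗮ := by
    intro x v hv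
    rw [Submodule.mem_orthogonal] at hv ⊢
    intro u hu
    have := hv (π (star x) u) (hinv _ u hu)
    rwa [inner_representation, star_star] at this
  obtain ⟨ξ₁, h₁, ξ₂, h₂, hsum⟩ := L.exists_add_mem_mem_orthogonal ξ
  by_cases hz₁ : ξ₁ = 0
  · left
    rw [← Submodule.orthogonal_eq_top_iff]
    refine htop _ (Submodule.isClosed_orthogonal L) hinv' ?_
    rw [hsum, hz₁, zero_add]
    exact h₂
  by_cases hz₂ : ξ₂ = 0
  · right
    refine htop _ hL hinv ?_
    rw [hsum, hz₂, add_zero]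
    exact h₁
  exfalso
  have horth₁ : ∀ x, inner ℂ ξ₁ (π x ξ₂) = 0 := fun x =>
    (Submodule.mem_orthogonal _ _).1 (hinv' x ξ₂ h₂) ξ₁ h₁
  have horth₂ : ∀ x, inner ℂ ξ₂ (π x ξ₁) = 0 := fun x =>
    (Submodule.mem_orthogonal' _ _).1 h₂ _ (hinv x ξ₁ h₁)
  have hsplit : ∀ x, vectorFunctional π ξ x = inner ℂ ξ₁ (π x ξ₁) + inner ℂ ξ₂ (π x ξ₂) := by
    intro x
    rw [vectorFunctional_apply, hsum, map_add, inner_add_left, inner_add_right, inner_add_right,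
      horth₁, horth₂, add_zero, zero_add]
  have hpyth : ‖ξ₁‖ ^ 2 + ‖ξ₂‖ ^ 2 = 1 := by
    have h3 := norm_add_sq_eq_norm_sq_add_norm_sq_of_inner_eq_zero (𝕜 := ℂ) ξ₁ ξ₂
      ((Submodule.mem_orthogonal _ _).1 h₂ ξ₁ h₁)
    rw [← hsum, hnorm] at h3
    linarith
  -- the normalized components
  have hnormalize : ∀ η : H, η ≠ 0 → ‖((‖η‖⁻¹ : ℝ) : ℂ) • η‖ = 1 := by
    intro η hη
    rw [norm_smul, Complex.norm_real, norm_inv, norm_norm, inv_mul_cancel₀ (norm_ne_zero_iff.2 hη)]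
  have hscale : ∀ η : H, η ≠ 0 → ∀ x,
      ((‖η‖ ^ 2 : ℝ) : ℂ) * vectorFunctional π (((‖η‖⁻¹ : ℝ) : ℂ) • η) x = inner ℂ η (π x η) := by
    intro η hη x
    have hne : (‖η‖ : ℂ) ≠ 0 := by exact_mod_cast norm_ne_zero_iff.2 hη
    rw [vectorFunctional_apply, map_smul, inner_smul_left, inner_smul_right, Complex.conj_ofReal]
    push_cast
    field_simp
  have hre : ∀ (n : ℕ) (η : H), (inner ℂ η (π (a n) η) : ℂ).re ≤ ‖η‖ ^ 2 := fun n η =>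
    (Complex.re_le_norm _).trans (hle n η)
  have hsum1 : ∀ n, (inner ℂ ξ₁ (π (a n) ξ₁) : ℂ).re + (inner ℂ ξ₂ (π (a n) ξ₂) : ℂ).re = 1 := by
    intro n
    rw [← Complex.add_re, ← hsplit, hone n, Complex.one_re]
  have hvalue : ∀ η : H, (∀ n, (inner ℂ η (π (a n) η) : ℂ).re = ‖η‖ ^ 2) →
      ∀ n, (inner ℂ η (π (a n) η) : ℂ) = ((‖η‖ ^ 2 : ℝ) : ℂ) := by
    intro η hη n
    have h3 := hle n η
    rw [← hη n] at h3
    have h4 := Complex.re_eq_norm.1 (le_antisymm (Complex.re_le_norm _) h3)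
    rw [← hη n]
    exact Complex.ext rfl (by rw [Complex.ofReal_im]; exact (Complex.nonneg_iff.1 h4).2.symm)
  have hmem : ∀ η : H, η ≠ 0 → (∀ n, (inner ℂ η (π (a n) η) : ℂ).re = ‖η‖ ^ 2) →
      vectorFunctional π (((‖η‖⁻¹ : ℝ) : ℂ) • η) ∈ quasiStatesOn J a := by
    intro η hη hn
    refine ⟨vectorFunctional_mem_quasiStates π (hnormalize η hη).le, fun x hx => ?_, fun n => ?_⟩
    · rw [vectorFunctional_apply, hJ x hx]
      simp
    · have h3 := hscale η hη (a n)
      rw [hvalue η hn n] at h3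
      have hne : ((‖η‖ ^ 2 : ℝ) : ℂ) ≠ 0 := by
        have := norm_ne_zero_iff.2 hη
        exact_mod_cast pow_ne_zero 2 this
      exact mul_left_cancel₀ hne (by rw [h3, mul_one])
  -- The real parts are at most `‖ξ₁‖²` and `‖ξ₂‖²`, while both pairs sum to `1`; so equality holds
  -- in each.
  have hm₁ := hmem ξ₁ hz₁ fun n => by linarith [hre n ξ₁, hre n ξ₂, hsum1 n]
  have hm₂ := hmem ξ₂ hz₂ fun n => by linarith [hre n ξ₁, hre n ξ₂, hsum1 n]
  have hseg : vectorFunctional π ξ ∈ openSegment ℝ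
      (vectorFunctional π (((‖ξ₁‖⁻¹ : ℝ) : ℂ) • ξ₁)) (vectorFunctional π (((‖ξ₂‖⁻¹ : ℝ) : ℂ) • ξ₂)) := by
    refine ⟨‖ξ₁‖ ^ 2, ‖ξ₂‖ ^ 2, pow_pos (norm_pos_iff.2 hz₁) 2, pow_pos (norm_pos_iff.2 hz₂) 2,
      hpyth, ?_⟩
    refine DFunLike.ext _ _ fun x => ?_
    rw [hsplit, ← hscale ξ₁ hz₁, ← hscale ξ₂ hz₂]
    rfl
  have heq := (hextr _ hm₁ _ hm₂ hseg).1
  -- Extremality identifies the functional of the normalised `ξ₁` with that of `ξ`. Testing on the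
  -- dense orbit of `ξ` makes `ξ₁` a multiple of `ξ`, which forces `ξ ∈ L`.
  have hproj : ξ₁ = ((‖ξ₁‖ ^ 2 : ℝ) : ℂ) • ξ := by
    refine hd.eq_of_inner_left ℂ ?_
    intro v hv
    obtain ⟨x, rfl⟩ := hv
    have h3 := hscale ξ₁ hz₁ x
    rw [heq, vectorFunctional_apply] at h3
    rw [inner_smul_left, Complex.conj_ofReal, h3]
    change inner ℂ ξ₁ (π x ξ) = _
    rw [hsum, map_add, inner_add_right, horth₁, add_zero]
  have hξL : ξ ∈ L := by
    have hne : ((‖ξ₁‖ ^ 2 : ℝ) : ℂ) ≠ 0 := by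
      have := norm_ne_zero_iff.2 hz₁
      exact_mod_cast pow_ne_zero 2 this
    rw [← Submodule.smul_mem_iff L hne, ← hproj]
    exact h₁
  have h2L : ξ₂ ∈ L := by
    have : ξ₂ = ξ - ξ₁ := by rw [hsum, add_sub_cancel_left]
    rw [this]
    exact L.sub_mem hξL h₁
  exact hz₂ (inner_self_eq_zero.1 ((Submodule.mem_orthogonal _ _).1 h₂ ξ₂ h2L))

/-- The compact convex set of these states has an extreme point, whose GNS kernel is primitive. It
contains `J` by cyclicity, and it misses each `a n` because the state is `1` there. -/
theorem exists_primitive {J : Submodule ℂ A} (hJ : IsClosedIdeal J) {a : ℕ → A}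
    (ha : ∀ n, ‖a n‖ ≤ 1) (hne : (quasiStatesOn J a).Nonempty) :
    ∃ P : Prim A, J ≤ P.1 ∧ ∀ n, a n ∉ P.1 := by
  have : LocallyConvexSpace ℝ (WeakDual ℂ A) :=
    inferInstanceAs (LocallyConvexSpace ℝ (WeakBilin (topDualPairing ℂ A)))
  obtain ⟨φ, hφ⟩ := (isCompact_quasiStatesOn J a).extremePoints_nonempty hne
  have hφK : φ ∈ quasiStatesOn J a := hφ.1
  obtain ⟨H, _, _, _, π, ξ, hξ, hd, rfl⟩ := exists_gns hφK.1
  have hker : ∀ x ∈ J, π x = 0 := by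
    intro x hx
    have hzero : ∀ y, π x (π y ξ) = 0 := by
      intro y
      have h1 := vectorFunctional_star_mul_self π ξ (x * y)
      rw [hφK.2.1 _ (hJ.2 (star (x * y)) _ (hJ.2 y x hx).2).1] at h1
      have h2 : ‖π (x * y) ξ‖ ^ 2 = 0 := by exact_mod_cast h1.symm
      rw [← mul_apply_eq_comp, ← map_mul]
      exact norm_eq_zero.1 (pow_eq_zero_iff two_ne_zero |>.1 h2)
    refine ContinuousLinearMap.ext_on (hd.mono Submodule.subset_span) ?_
    rintro _ ⟨y, rfl⟩
    exact hzero y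
  have hirr := isIrreducible_of_extreme hξ hd hker ha hφ
  refine ⟨⟨kernel π, H, _, _, _, π, hirr, rfl⟩, hker, fun n hn => ?_⟩
  have h1 := hφK.2.2 n
  rw [vectorFunctional_apply, mem_kernel.1 hn] at h1
  simp at h1

end PurePoint

/-! ### Baire and Lindelöf properties of the primitive spectrum. -/

section Baire

variable {A : Type u} [NonUnitalCStarAlgebra A]

theorem IsPrimitive.exists_mul_notMem {P : Submodule ℂ A} (hP : IsPrimitive P) {e x : A}
    (he : e ∉ P) (hx : x ∉ P) : ∃ y, e * (y * x) ∉ P := by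
  obtain ⟨H, _, _, _, ρ, hρ, rfl⟩ := hP
  by_contra! hcon
  obtain ⟨v, hv⟩ : ∃ v, ρ x v ≠ 0 := by
    by_contra! h
    exact hx (ContinuousLinearMap.ext h)
  refine he (ContinuousLinearMap.ext_on ((hρ.dense_range hv).mono Submodule.subset_span) ?_)
  rintro _ ⟨y, rfl⟩
  have h1 := mem_kernel.1 (hcon y)
  rw [map_mul, map_mul] at h1
  exact DFunLike.congr_fun h1 v

theorem IsPrimitive.star_mul_self_notMem {P : Submodule ℂ A} (hP : IsPrimitive P) {x : A}
    (hx : x ∉ P) : star x * x ∉ P := by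
  obtain ⟨H, _, _, _, ρ, hρ, rfl⟩ := hP
  intro h
  rw [mem_kernel, map_mul, map_star, CStarRing.star_mul_self_eq_zero_iff] at h
  exact hx h

theorem exists_cut_notMem {P : Submodule ℂ A} (hP : IsClosed (P : Set A)) {x : A}
    (hx : star x * x ∉ P) : ∃ ε : ℝ, 0 < ε ∧ cfcₙ (cut (2 * ε)) (star x * x) ∉ P := by
  by_contra! hcon
  apply hx
  rw [← SetLike.mem_coe, ← hP.closure_eq, Metric.mem_closure_iff]
  intro δ hδ
  refine ⟨_, hcon (δ / 4) (by positivity), ?_⟩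
  rw [dist_comm, dist_eq_norm]
  refine (norm_cfcₙ_cut_sub_le x (by positivity)).trans_lt ?_
  linarith

/-- A closed subset `F` of the primitive spectrum is a Baire space. -/
theorem exists_open_inter_subset {F : Set (Prim A)} (hF : IsClosed F) (hne : F.Nonempty)
    {G : ℕ → Set (Prim A)} (hG : ∀ n, IsClosed (G n)) (hcover : F ⊆ ⋃ n, G n) :
    ∃ (n : ℕ) (U : Set (Prim A)), IsOpen U ∧ (U ∩ F).Nonempty ∧ U ∩ F ⊆ G n := by
  by_contra! hcon
  obtain ⟨J, hJ, rfl⟩ := isClosed_iff_exists_hull.1 hF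
  choose I hI hGI using fun n => isClosed_iff_exists_hull.1 (hG n)
  have hstep : ∀ (n : ℕ) (e : {e : A // ∃ P ∈ hull J, e ∉ P.1}), ∃ p : A × ℝ,
      IsSelfAdjoint p.1 ∧ 0 < p.2 ∧ p.1 ∈ I n ∧ (∃ z, p.1 = e.1 * z) ∧
        ∃ P ∈ hull J, cfcₙ (cut (2 * p.2)) p.1 ∉ P.1 := by
    rintro n ⟨e, P, hP, heP⟩
    obtain ⟨Q, ⟨heQ, hQ⟩, hQG⟩ := Set.not_subset.1
      (hcon n {Q | e ∉ Q.1} (isOpen_setOf_notMem e) ⟨P, heP, hP⟩)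
    rw [hGI n] at hQG
    obtain ⟨x, hx, hxQ⟩ := SetLike.not_le_iff_exists.1 (show ¬ I n ≤ Q.1 from hQG)
    obtain ⟨y, hy⟩ := Q.2.exists_mul_notMem heQ hxQ
    -- This is `z z⋆` with `z = e y x`: positive, in `I n` through `x`, and with left factor `e`,
    -- which makes the construction nested.
    have hstar : star (star (e * (y * x))) * star (e * (y * x)) ∉ Q.1 := by
      refine Q.2.star_mul_self_notMem fun h => ?_
      obtain ⟨H, _, _, _, ρ, hρ, hker⟩ := Q.2
      rw [← hker, mem_kernel, map_star, star_eq_zero] at h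
      rw [← hker] at hy
      exact hy h
    obtain ⟨ε, hε, hcut⟩ := exists_cut_notMem Q.2.isClosedIdeal.1 hstar
    refine ⟨⟨_, ε⟩, IsSelfAdjoint.star_mul_self _, hε, ?_, ?_, Q, hQ, hcut⟩
    · rw [star_star]
      exact ((hI n).2 _ _ ((hI n).2 e _ ((hI n).2 y x hx).1).1).2
    · exact ⟨y * x * star (e * (y * x)), by rw [star_star, mul_assoc e]⟩
  choose! p hsa hpos hmem hmul hcut using hstep
  obtain ⟨P₀, hP₀⟩ := hne
  obtain ⟨e₀, -, he₀⟩ := SetLike.exists_of_lt (lt_top_iff_ne_top.2 P₀.2.ne_top)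
  let E : ℕ → {e : A // ∃ P ∈ hull J, e ∉ P.1} := fun n =>
    Nat.rec ⟨e₀, P₀, hP₀, he₀⟩ (fun n e => ⟨cfcₙ (cut (2 * (p n e).2)) (p n e).1, hcut n e⟩) n
  have hE : ∀ n, (E (n + 1)).1 = cfcₙ (cut (2 * (p n (E n)).2)) (p n (E n)).1 := fun n => rfl
  let a : ℕ → A := fun n => cfcₙ (step (p n (E n)).2) (p n (E n)).1
  have haE : ∀ n, a n * (E (n + 1)).1 = (E (n + 1)).1 := fun n => by
    rw [hE]
    exact cfcₙ_step_mul_cut _ (hpos _ _)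
  have hEE : ∀ n, ∃ z, (E (n + 1)).1 = (E n).1 * z := by
    intro n
    obtain ⟨z, hz⟩ := hmul n (E n)
    obtain ⟨c, hc⟩ := exists_cut_eq_mul (hsa n (E n)) (ε := 2 * (p n (E n)).2)
      (mul_pos two_pos (hpos _ _))
    exact ⟨z * c, by rw [hE, hc, ← mul_assoc, ← hz]⟩
  -- Each `E (m + 1)` is a right multiple of `E m`, so whatever fixes `E (k + 1)` from the left
  -- fixes all later terms.
  have haE' : ∀ k m, k + 1 ≤ m → a k * (E m).1 = (E m).1 := by
    intro k m hkm
    induction m, hkm using Nat.le_induction with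
    | base => exact haE k
    | succ m _ ih =>
      obtain ⟨z, hz⟩ := hEE m
      rw [hz, ← mul_assoc, ih]
  have haI : ∀ n, a n ∈ I n := by
    intro n
    obtain ⟨c, hc⟩ := exists_step_eq_mul (hsa n (E n)) (hpos n (E n))
    change cfcₙ _ _ ∈ _
    rw [hc]
    exact ((hI n).2 c _ (hmem n (E n))).2
  have hanorm : ∀ n, ‖a n‖ ≤ 1 := fun n => norm_cfcₙ_le fun t _ => by
    rw [Real.norm_eq_abs, abs_of_nonneg (step_nonneg _ _)]
    exact step_le_one _ _
  have hstates : (quasiStatesOn J a).Nonempty := by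
    refine quasiStatesOn_nonempty J a fun n => ?_
    obtain ⟨P, hP, hPE⟩ := (E (n + 1)).2
    obtain ⟨H, _, _, _, ρ, hρ, hker⟩ := P.2
    rw [← hker] at hPE
    obtain ⟨v, hv⟩ : ∃ v, ρ (E (n + 1)).1 v ≠ 0 := by
      by_contra! h
      exact hPE (ContinuousLinearMap.ext h)
    -- A vector in this range is fixed by `a 0, …, a n` simultaneously, so its vector state is `1`
    -- on all of them.
    set η := ρ (E (n + 1)).1 v with hη
    have hnorm : ‖((‖η‖⁻¹ : ℝ) : ℂ) • η‖ = 1 := by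
      rw [norm_smul, Complex.norm_real, norm_inv, norm_norm,
        inv_mul_cancel₀ (norm_ne_zero_iff.2 hv)]
    refine ⟨vectorFunctional ρ (((‖η‖⁻¹ : ℝ) : ℂ) • η),
      vectorFunctional_mem_quasiStates ρ hnorm.le, fun x hx => ?_, fun k hk => ?_⟩
    · have h1 : x ∈ kernel ρ := hker ▸ hP hx
      rw [vectorFunctional_apply, mem_kernel.1 h1]
      simp
    · have h1 : ρ (a k) η = η := by
        rw [hη, ← mul_apply_eq_comp, ← map_mul, haE' k (n + 1) (by omega)]
      rw [vectorFunctional_apply, map_smul, h1, inner_self_eq_norm_sq_to_K, hnorm]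
      simp
  obtain ⟨P, hP, haP⟩ := exists_primitive hJ hanorm hstates
  obtain ⟨n, hn⟩ := Set.mem_iUnion.1 (hcover hP)
  rw [hGI n] at hn
  exact haP n (hn (haI n))

/-- Open sets correspond to ideals. A countable dense subset of the union of these ideals selects
countably many of them, and since `P` is closed, some dense element detects that an ideal is not
inside `P`. -/
theorem isLindelof_prim [TopologicalSpace.SeparableSpace A] (s : Set (Prim A)) : IsLindelof s := by
  refine isLindelof_of_countable_subcover fun {ι} U hU hs => ?_
  choose I hI hUI using fun i => isClosed_iff_exists_hull.1 (isClosed_compl_iff.2 (hU i))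
  have hmemU : ∀ i P, P ∈ U i ↔ ¬ I i ≤ P.1 := by
    intro i P
    rw [← not_iff_not, ← Set.mem_compl_iff, hUI i, not_not]
    rfl
  obtain ⟨D, hD, hDc, hDd⟩ := (TopologicalSpace.IsSeparable.of_separableSpace
    (⋃ i, (I i : Set A))).exists_countable_dense_subset
  have hDc' : Countable D := hDc
  choose f hf using fun x : D => Set.mem_iUnion.1 (hD x.2)
  refine ⟨Set.range f, Set.countable_range f, fun P hP => ?_⟩
  obtain ⟨i, hi⟩ := Set.mem_iUnion.1 (hs hP)
  obtain ⟨x, hx, hxP⟩ := SetLike.not_le_iff_exists.1 ((hmemU i P).1 hi)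
  have hopen : IsOpen ((P.1 : Set A)ᶜ) := P.2.isClosedIdeal.1.isOpen_compl
  obtain ⟨y, hyP, hyD⟩ := mem_closure_iff.1 (hDd (Set.mem_iUnion.2 ⟨i, hx⟩)) _ hopen hxP
  refine Set.mem_biUnion (Set.mem_range_self (⟨y, hyD⟩ : D)) ?_
  rw [hmemU]
  exact fun h => hyP (h (hf ⟨y, hyD⟩))

end Baire

/-! ### Countability of the order. -/

section Order

variable {X : Type u} [TopologicalSpace X]

theorem mem_orderLE {w : X → ℕ∞} {α : Ordinal.{u}} {x : X} :
    x ∈ orderLE w α ↔ w x < ⊤ ∧ ∃ U ∈ 𝓝 x, ∃ n : ℕ, ∀ y ∈ U,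
      (∃ β : Ordinal.{u}, ∃ _ : β < α, y ∈ orderLE w β) ∨ w y ≤ n := by
  rw [orderLE]
  rfl

theorem orderLE_mono (w : X → ℕ∞) : Monotone (orderLE w) := by
  intro α β hαβ x hx
  rw [mem_orderLE] at hx ⊢
  obtain ⟨hfin, U, hU, n, h⟩ := hx
  refine ⟨hfin, U, hU, n, fun y hy => (h y hy).imp_left ?_⟩
  rintro ⟨γ, hγ, hyγ⟩
  exact ⟨γ, hγ.trans_le hαβ, hyγ⟩

theorem isOpen_orderLE {w : X → ℕ∞} (hw : ∀ x, w x < ⊤) (α : Ordinal.{u}) :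
    IsOpen (orderLE w α) := by
  rw [isOpen_iff_forall_mem_open]
  intro x hx
  obtain ⟨-, U, hU, n, h⟩ := mem_orderLE.1 hx
  obtain ⟨V, hVU, hV, hxV⟩ := mem_nhds_iff.1 hU
  refine ⟨V, fun y hy => ?_, hV, hxV⟩
  rw [mem_orderLE]
  exact ⟨hw y, V, hV.mem_nhds hy, n, fun z hz => h z (hVU hz)⟩

/-- A finite-valued function with closed sublevel sets on a hereditarily Lindelöf space all of whose
closed subspaces are Baire has countable order. -/
theorem exists_forall_mem_orderLE {w : X → ℕ∞} (hw : ∀ x, w x < ⊤)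
    (hcl : ∀ n : ℕ, IsClosed {x | w x ≤ n}) (hlindelof : ∀ s : Set X, IsLindelof s)
    (hbaire : ∀ F : Set X, IsClosed F → F.Nonempty → ∀ G : ℕ → Set X, (∀ n, IsClosed (G n)) →
      F ⊆ ⋃ n, G n → ∃ (n : ℕ) (U : Set X), IsOpen U ∧ (U ∩ F).Nonempty ∧ U ∩ F ⊆ G n) :
    ∃ γ : Ordinal.{u}, γ < Ordinal.omega 1 ∧ ∀ x, x ∈ orderLE w γ := by
  -- The union over all countable ordinals is already a countable subunion; the supremum of its
  -- indices is the stable stage `γ`.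
  obtain ⟨t, htc, ht⟩ := (hlindelof (⋃ α : Set.Iio (Ordinal.omega.{u} 1), orderLE w α.1)
    ).elim_countable_subcover (fun α : Set.Iio (Ordinal.omega.{u} 1) => orderLE w α.1)
    (fun α => isOpen_orderLE hw α.1) subset_rfl
  have htc' : Countable t := htc
  obtain ⟨γ, hγ, htγ⟩ : ∃ γ : Ordinal.{u}, γ < Ordinal.omega 1 ∧ ∀ α ∈ t, α.1 ≤ γ := by
    refine ⟨⨆ α : t, α.1.1, Ordinal.iSup_lt_omega_one fun α => α.1.2, fun α hα => ?_⟩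
    refine le_ciSup (f := fun α : t => α.1.1) ⟨Ordinal.omega 1, ?_⟩ ⟨α, hα⟩
    rintro _ ⟨β, rfl⟩
    exact β.1.2.le
  have hstable : ∀ α, α < Ordinal.omega.{u} 1 → orderLE w α ⊆ orderLE w γ := by
    intro α hα x hx
    obtain ⟨β, hβ, hxβ⟩ := Set.mem_iUnion₂.1 (ht (Set.mem_iUnion.2 ⟨⟨α, hα⟩, hx⟩))
    exact orderLE_mono w (htγ β hβ) hxβ
  refine ⟨γ, hγ, ?_⟩
  by_contra! hcon
  obtain ⟨n, U, hU, ⟨x, hxU, hxF⟩, hUG⟩ := hbaire (orderLE w γ)ᶜ (isOpen_orderLE hw γ).isClosed_compl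
    hcon (fun n => {x | w x ≤ n}) hcl (fun x _ => by
      obtain ⟨n, hn⟩ := ENat.ne_top_iff_exists.1 (hw x).ne
      exact Set.mem_iUnion.2 ⟨n, hn.symm.le⟩)
  have hsucc : γ + 1 < Ordinal.omega.{u} 1 :=
    Ordinal.isPrincipal_add_omega 1 hγ (Ordinal.one_lt_omega0.trans Ordinal.omega0_lt_omega_one)
  refine hxF (hstable _ hsucc ?_)
  rw [mem_orderLE]
  refine ⟨hw x, U, hU.mem_nhds hxU, n, fun y hy => ?_⟩
  by_cases hyγ : y ∈ orderLE w γ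
  · exact Or.inl ⟨γ, lt_add_one γ, hyγ⟩
  · exact Or.inr (hUG ⟨hy, hyγ⟩)

end Order

/-! ### Ranks, Fell ideals and the two implications. -/

section Main

variable {X : Type u} [TopologicalSpace X]

/-- The finite summand `w x` is absorbed by one extra `ω`. -/
theorem functionRank_le {w : X → ℕ∞} {γ : Ordinal.{u}} (h : ∀ x, x ∈ orderLE w γ) :
    functionRank w ≤ ((Ordinal.omega0 * γ + Ordinal.omega0 : Ordinal.{u}) : WithTop Ordinal.{u}) := by
  refine iSup_le fun x => ?_
  have hle : order w x ≤ (γ : WithTop Ordinal.{u}) := sInf_le ⟨γ, h x, rfl⟩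
  obtain ⟨β, hβ, hβγ⟩ := WithTop.le_coe_iff.1 hle
  rw [pointRank, hβ, WithTop.map_coe, WithTop.coe_le_coe]
  exact add_le_add (mul_le_mul_right hβγ _) (Ordinal.natCast_lt_omega0 _).le

theorem lt_top_of_functionRank_le {w : X → ℕ∞} {γ : Ordinal.{u}} (h : functionRank w ≤ γ) (x : X) :
    w x < ⊤ := by
  have hx : pointRank w x ≤ (γ : WithTop Ordinal.{u}) := (le_iSup (pointRank w) x).trans h
  have hne : order w x ≠ ⊤ := by
    intro htop
    rw [pointRank, htop, WithTop.map_top, top_le_iff] at hx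
    exact WithTop.coe_ne_top hx
  have hex : ∃ α, x ∈ orderLE w α := by
    by_contra! hcon
    apply hne
    rw [order]
    have : {α | x ∈ orderLE w α} = ∅ := Set.eq_empty_of_forall_notMem hcon
    rw [this, Set.image_empty, sInf_empty]
  obtain ⟨α, hα⟩ := hex
  exact (mem_orderLE.1 hα).1

variable {A : Type u} [NonUnitalCStarAlgebra A]

theorem HasFiniteRank.exists_pedersenRank_le [TopologicalSpace.SeparableSpace A] {b : A}
    (hfin : HasFiniteRank A b) (hb : IsSelfAdjoint b) :
    ∃ δ : Ordinal.{u}, δ < Ordinal.omega 1 ∧ pedersenRank b ≤ δ := by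
  obtain ⟨γ, hγ, h⟩ := exists_forall_mem_orderLE (hfin.pedersenFunction_lt_top hb)
    (hfin.isClosed_setOf_le hb) isLindelof_prim
    fun F hF hne G hG hcover => exists_open_inter_subset hF hne hG hcover
  exact ⟨_, Ordinal.isPrincipal_add_omega 1 (Ordinal.isPrincipal_mul_omega 1
    Ordinal.omega0_lt_omega_one hγ) Ordinal.omega0_lt_omega_one, functionRank_le h⟩

theorem IsLiminary.hasFiniteRank_cut (hA : IsLiminary A) {a : A} (ha : IsSelfAdjoint a) {ε : ℝ}
    (hε : 0 < ε) : HasFiniteRank A (cfcₙ (cut (2 * ε)) a) := fun H _ _ _ ρ hρ =>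
  operatorRank_lt_top (finiteDimensional_range_cut ρ ha (hA H ρ hρ a) hε)

/-- A closed ideal which contains the elements `(x⋆x - 2ε)₊` for a dense set of elements `x` and
arbitrarily small `ε` is everything. -/
theorem IsClosedIdeal.eq_top_of_cut_mem {J : Submodule ℂ A} (hJ : IsClosedIdeal J) {s : Set A}
    (hs : Dense s) (h : ∀ x ∈ s, ∀ m : ℕ,
      cfcₙ (cut (2 * (1 / ((m : ℝ) + 1)))) (star x * x) ∈ J) : J = ⊤ := by
  have h1 : ∀ x ∈ s, star x * x ∈ J := by
    intro x hx
    by_contra hcon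
    have hclosed := hJ.1
    rw [← SetLike.mem_coe, ← hclosed.closure_eq, Metric.mem_closure_iff] at hcon
    apply hcon
    intro δ hδ
    obtain ⟨m, hm⟩ := exists_nat_one_div_lt (half_pos hδ)
    refine ⟨_, h x hx m, ?_⟩
    rw [dist_comm, dist_eq_norm]
    refine (norm_cfcₙ_cut_sub_le x (by positivity)).trans_lt ?_
    linarith
  have h2 : ∀ x, star x * x ∈ J := by
    intro x
    rw [← SetLike.mem_coe, ← hJ.1.closure_eq]
    exact map_mem_closure (f := fun x : A => star x * x) (by fun_prop) (hs x) h1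
  let _ := CStarAlgebra.spectralOrder A
  have := CStarAlgebra.spectralOrderedRing A
  -- Positive elements span `A`, and each has the form `x⋆x`.
  rw [eq_top_iff, ← CStarAlgebra.span_nonneg (A := A), Submodule.span_le]
  intro a ha
  obtain ⟨x, rfl⟩ := CStarAlgebra.nonneg_iff_eq_star_mul_self.1 (show 0 ≤ a from ha)
  exact h2 x

theorem IsLiminary.exists_isTypeI [TopologicalSpace.SeparableSpace A] (hA : IsLiminary A) :
    ∃ α : Ordinal.{u}, α < Ordinal.omega 1 ∧ IsTypeI A α := by
  have hsa : ∀ x : A, IsSelfAdjoint (star x * x) := IsSelfAdjoint.star_mul_self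
  have hex : ∀ p : ℕ × ℕ, ∃ δ : Ordinal.{u}, δ < Ordinal.omega 1 ∧
      pedersenRank (cfcₙ (cut (2 * (1 / ((p.2 : ℝ) + 1))))
        (star (TopologicalSpace.denseSeq A p.1) * TopologicalSpace.denseSeq A p.1)) ≤ δ := fun p =>
    (hA.hasFiniteRank_cut (hsa _) (by positivity)).exists_pedersenRank_le (cfcₙ_predicate _ _)
  choose δ hδ hrank using hex
  refine ⟨⨆ p, δ p, Ordinal.iSup_lt_omega_one hδ, ?_⟩
  refine (closedIdealSpan_isClosedIdeal _).eq_top_of_cut_mem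
    (TopologicalSpace.denseRange_denseSeq A) ?_
  rintro _ ⟨n, rfl⟩ m
  refine subset_closedIdealSpan _ ((hrank (n, m)).trans ?_)
  rw [WithTop.coe_le_coe]
  -- The shift in `IsTypeI` is harmless, as `α ≤ 1 + α`.
  exact (Ordinal.le_iSup δ (n, m)).trans le_add_self

theorem IsTypeI.isLiminary {α : Ordinal.{u}} (h : IsTypeI A α) : IsLiminary A := by
  intro H _ _ _ π hπ a
  let K : Submodule ℂ A :=
    { carrier := {x | IsCompactOperator (π x)}
      add_mem' := fun {x y} hx hy => by
        change IsCompactOperator (π (x + y))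
        rw [map_add]
        exact IsCompactOperator.add hx hy
      zero_mem' := by
        change IsCompactOperator (π 0)
        rw [map_zero]
        exact isCompactOperator_zero
      smul_mem' := fun c x hx => by
        change IsCompactOperator (π (c • x))
        rw [map_smul]
        exact IsCompactOperator.smul hx c }
  have hK : IsClosedIdeal K := by
    refine ⟨?_, fun x y hy => ⟨?_, ?_⟩⟩
    · exact (isClosed_setOfPred_isCompactOperator (σ₁₂ := RingHom.id ℂ) (M₁ := H) (M₂ := H)).preimage
        (continuous_representation π)
    · change IsCompactOperator (π (x * y))
      rw [map_mul]
      exact IsCompactOperator.clm_comp hy (π x)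
    · change IsCompactOperator (π (y * x))
      rw [map_mul]
      exact IsCompactOperator.comp_clm hy (π x)
  have hle : fellIdeal A (1 + α) ≤ K := by
    refine closedIdealSpan_le hK fun x hx => ?_
    have hfin := lt_top_of_functionRank_le hx ⟨kernel π, H, _, _, _, π, hπ, rfl⟩
    have := finiteDimensional_of_operatorRank_lt_top
      ((operatorRank_le_pedersenFunction hπ rfl x).trans_lt hfin)
    change IsCompactOperator (π x)
    have hr : IsCompactOperator (LinearMap.rangeRestrict (π x : H →ₗ[ℂ] H)) := by
      have : ProperSpace (LinearMap.range (π x : H →ₗ[ℂ] H)) := FiniteDimensional.proper ℂ _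
      exact isCompactOperator_of_locallyCompactSpace_dom
        (ContinuousLinearMap.codRestrict (π x) (LinearMap.range (π x : H →ₗ[ℂ] H)) fun v => ⟨v, rfl⟩)
    exact hr.clm_comp (Submodule.subtypeL (LinearMap.range (π x : H →ₗ[ℂ] H)))
  rw [IsTypeI] at h
  rw [h] at hle
  exact hle Submodule.mem_top

end Main

end CStarRank

theorem mainTheorem1 (A : Type u) [NonUnitalCStarAlgebra A] [TopologicalSpace.SeparableSpace A] :
    CStarRank.IsLiminary A ↔
      ∃ α : Ordinal.{u}, α < Ordinal.omega 1 ∧ CStarRank.IsTypeI A α :=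
  ⟨fun h => h.exists_isTypeI, fun ⟨_, _, h⟩ => h.isLiminary⟩
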